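/- **Setting.** Let $\Theta\subset\mathbb R^d$ be nonempty, compact and convex. Let $A,B$ be nonempty compact subsets of the simplex $\Delta^{n-1}=\{c\in\mathbb R^n: c_i\ge 0,\ \sum_i c_i=1\}$, let $\varphi\in[0,1)$, and assume that $$\Lambda:=\Lambda_\varphi(A,B)=\Big\{\tfrac{1}{1-\varphi}(a-\varphi b): a\in A,\ b\in B\Big\}$$ is convex. Put $\|\Lambda\|_1=\max_{\lambda\in\Lambda}\sum_i|\lambda_i|$ and $D(x,y)=\tfrac12\|x-y\|_2^2$. Let $f_1,\dots,f_n\in C^1(\mathbb R^d;[0,\infty))$ and $m_f,M_f>0$ satisfy $$\tfrac{m_f}{2}\|x-y\|_2^2\le f_i(x)-f_i(y)-\langle\nabla f_i(y),x-y\rangle\le\tfrac{M_f}{2}\|x-y\|_2^2\qquad (x,y\in\mathbb R^d,\ i=1,\dots,n),$$ and let $\|(f_i(\theta)-f_i(\theta'))_{i}\|_2\le L_{\lambda\theta}\|\theta-\theta'\|_2$ for $\theta,\theta'\in\Theta$, where $L_{\lambda\theta}>0$. Let $J\ge2$ and $F(\theta,\lambda)=\sum_i\lambda_if_i(\theta)$.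 A *solution* is a pair $(\theta^\star,\lambda^\star)\in\Theta\times\Lambda$ with $F(\theta^\star,\lambda^\star)=\min_{\theta\in\Theta}\max_{\lambda\in\Lambda}F(\theta,\lambda)$ and $F(\theta^\star,\lambda)\le F(\theta^\star,\lambda^\star)\le F(\theta,\lambda^\star)$ for all $\theta\in\Theta$, $\lambda\in\Lambda$. **Stochastic gradients.** A stochastic model with noise level $\delta_g\ge0$ consists of a measurable space $\mathbb X$, probability laws $P_i$ on $\mathbb X$ and jointly measurable functions $f_i(\theta,x)\ge0$, differentiable in $\theta$, with $f_i(\theta)=\mathbb E_{\xi\sim P_i}f_i(\theta,\xi)$, $\nabla f_i(\theta)=\mathbb E_{\xi\sim P_i}\nabla_\theta f_i(\theta,\xi)$ and $\mathbb E_{\xi\sim P_i}\|\nabla_\theta f_i(\theta,\xi)-\nabla f_i(\theta)\|_2^2\le\delta_g^2$ for all $i$ and $\theta\in\mathbb R^d$. The samples $\xi^r_{i,j}\sim P_i$ ($1\le i\le n$, $0\le j\le J$, $r\ge1$) are mutually independent. **Algorithm (Scaff-PD-IA).** Given positive hyperparameters $\sigma_r,\tau_r,\varsigma_r,\eta_r$,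 start from $\theta^1=\theta^0\in\Theta$, $\lambda^1=\lambda^0\in\Lambda$. In rounds $r=1,\dots,R$, with $L^r=(f_1(\theta^r),\dots,f_n(\theta^r))$, set $s^r=(1+\varsigma_r)L^r-\varsigma_rL^{r-1}$ and $\lambda^{r+1}=\frac{1}{1-\varphi}(a^{r+1}-\varphi b^{r+1})$, where $(a^{r+1},b^{r+1})$ minimizes $$-\Big\langle s^r,\tfrac{1}{1-\varphi}(a-\varphi b)\Big\rangle+\tfrac1{2\sigma_r}\Big\|\tfrac{1}{1-\varphi}(a-\varphi b)-\lambda^r\Big\|_2^2$$ over $A\times B$. With $c_i^r=\nabla_\theta f_i(\theta^r,\xi^r_{i,0})$ and $c^r=\sum_i\lambda_i^{r+1}c_i^r$, each client sets $u_{i,0}=\theta^r$, $u_{i,j}=u_{i,j-1}-\eta_r(\nabla_\theta f_i(u_{i,j-1},\xi^r_{i,j})-c_i^r+c^r)$ for $j=1,\dots,J$, and $\Delta u_i^r=(\theta^r-u_{i,J})/(\eta_rJ)$. Finally $\theta^{r+1}$ minimizes $\langle\sum_i\lambda_i^{r+1}\Delta u_i^r,\theta\rangle+\frac1{2\tau_r}\|\theta-\theta^r\|_2^2$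 over $\theta\in\Theta$. The run *needs no projection* if almost surely $\theta^r-\tau_r\sum_i\lambda_i^{r+1}\Delta u_i^r\in\Theta$ for $r=1,\dots,R$. **Theorem.** Suppose $\|\Lambda\|_1<1+2m_f/M_f$. Then there are a unique $\theta^\star\in\Theta$ and a unique nonempty $\Lambda^\star\subset\Lambda$ such that the set of solutions is $\{\theta^\star\}\times\Lambda^\star$. Moreover, for every $\varepsilon>0$ there are positive hyperparameter sequences $(\sigma_r),(\tau_r),(\varsigma_r),(\eta_r)$ with $\tau_r\le\varepsilon$ and $\eta_r\le\varepsilon$ for all $r$, and constants $C_1,C_2\ge1$, such that for every stochastic model with any noise level $\delta_g\ge0$, every $R\ge1$, $\theta^0\in\Theta$, $\lambda^0\in\Lambda$ and $\lambda^\star\in\Lambda^\star$, and every run of Scaff-PD-IA with these hyperparameters that needs no projection, $$\mathbb E\big[\|\theta^{R+1}-\theta^\star\|_2^2\big]\le\frac{C_1\delta_g^2}{R}+\frac{C_2}{R^2}\Big(D(\theta^\star,\theta^0)+D(\lambda^\star,\lambda^0)+F(\theta^0,\lambda^\star)-F(\theta^\star,\lambda^0)\Big).$$ -/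

import Mathlib

open MeasureTheory ProbabilityTheory

noncomputable section

namespace ScaffPDIA

/-- Euclidean space `ℝᵏ` with the `ℓ²` norm. -/
abbrev Vec (k : ℕ) : Type := EuclideanSpace ℝ (Fin k)

/-- The probability simplex `Δⁿ⁻¹` in `ℝⁿ`. -/
def simplex (n : ℕ) : Set (Vec n) := {c | (∀ i, 0 ≤ c i) ∧ ∑ i, c i = 1}

/-- The integrated weight `(a - φ b) / (1 - φ)`. -/
def combine {n : ℕ} (φ : ℝ) (a b : Vec n) : Vec n := (1 / (1 - φ)) • (a - φ • b)

/-- The integrated ambiguity set `Λ_φ(A, B)`. -/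
def integratedSet {n : ℕ} (φ : ℝ) (A B : Set (Vec n)) : Set (Vec n) :=
  {l | ∃ a ∈ A, ∃ b ∈ B, l = combine φ a b}

/-- `‖C‖₁ = max_{c ∈ C} ∑ᵢ |cᵢ|` for a nonempty compact set `C`. -/
def l1Norm {n : ℕ} (C : Set (Vec n)) : ℝ := sSup ((fun c : Vec n => ∑ i, |c i|) '' C)

/-- `D(x, y) = ‖x - y‖² / 2`. -/
def halfSqDist {k : ℕ} (x y : Vec k) : ℝ := ‖x - y‖ ^ 2 / 2

/-- The objective `F(θ, λ) = ∑ᵢ λᵢ fᵢ(θ)`. -/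
def objective {d n : ℕ} (f : Fin n → Vec d → ℝ) (θ : Vec d) (l : Vec n) : ℝ :=
  ∑ i, l i * f i θ

/-- The loss vector `(f₁(θ), …, fₙ(θ))`. -/
def lossVec {d n : ℕ} (f : Fin n → Vec d → ℝ) (θ : Vec d) : Vec n :=
  WithLp.toLp 2 (fun i => f i θ)

/-- `(θ, λ)` is a solution of `min_{θ ∈ Θ} max_{λ ∈ Λ} F(θ, λ)`: it attains the minimax value and
it is a saddle point. -/
structure IsSolution {d n : ℕ} (f : Fin n → Vec d → ℝ) (Θ : Set (Vec d)) (Λ : Set (Vec n))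
    (p : Vec d × Vec n) : Prop where
  mem_primal : p.1 ∈ Θ
  mem_dual : p.2 ∈ Λ
  minimax : IsLeast ((fun θ => sSup (objective f θ '' Λ)) '' Θ) (objective f p.1 p.2)
  dual_le : ∀ l ∈ Λ, objective f p.1 l ≤ objective f p.1 p.2
  le_primal : ∀ θ ∈ Θ, objective f p.1 p.2 ≤ objective f θ p.2

/-- The losses are nonnegative and `C¹` on the whole space, uniformly `m`-strongly convex and
`M`-smooth. -/
structure IsRegularLoss {d n : ℕ} (f : Fin n → Vec d → ℝ) (m M : ℝ) : Prop where
  nonneg : ∀ i x, 0 ≤ f i x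
  contDiff : ∀ i, ContDiff ℝ 1 (f i)
  strong : ∀ i x y, m / 2 * ‖x - y‖ ^ 2 ≤ f i x - f i y - inner ℝ (gradient (f i) y) (x - y)
  smooth : ∀ i x y, f i x - f i y - inner ℝ (gradient (f i) y) (x - y) ≤ M / 2 * ‖x - y‖ ^ 2

/-- The gradient `∇_θ fᵢ(θ, x)` of the sample loss of one client. -/
def sampleGrad {d : ℕ} {X : Type*} (g : Vec d → X → ℝ) (θ : Vec d) (x : X) : Vec d :=
  gradient (fun θ' => g θ' x) θ

/-- The sample losses `g i θ x = fᵢ(θ, x)`, with `x` drawn from the law `P i`, are an unbiased model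
of the losses `f i` and of their gradients; the variance of the gradients is at most `δ²`. -/
structure IsStochasticModel {d n : ℕ} {X : Type*} [MeasurableSpace X] (f : Fin n → Vec d → ℝ)
    (g : Fin n → Vec d → X → ℝ) (P : Fin n → Measure X) (δ : ℝ) : Prop where
  isProb : ∀ i, IsProbabilityMeasure (P i)
  measurable : ∀ i, Measurable (fun q : Vec d × X => g i q.1 q.2)
  nonneg : ∀ i θ x, 0 ≤ g i θ x
  differentiable : ∀ i x, Differentiable ℝ (fun θ => g i θ x)
  integrable : ∀ i θ, Integrable (g i θ) (P i)
  mean : ∀ i θ, f i θ = ∫ x, g i θ x ∂(P i)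
  integrable_grad : ∀ i θ, Integrable (sampleGrad (g i) θ) (P i)
  mean_grad : ∀ i θ, gradient (f i) θ = ∫ x, sampleGrad (g i) θ x ∂(P i)
  variance_le : ∀ i θ,
    ∫⁻ x, ‖sampleGrad (g i) θ x - ∫ y, sampleGrad (g i) θ y ∂(P i)‖ₑ ^ 2 ∂(P i)
      ≤ ENNReal.ofReal (δ ^ 2)

/-- The samples `ξ i j r`, for clients `i`, local steps `0 ≤ j ≤ J` and rounds `r ≥ 1`, are mutually
independent, and `ξ i j r` has the law `P i`. Other indices are not used. -/
structure IsSampling {n : ℕ} {X Ω : Type*} [MeasurableSpace X] [MeasurableSpace Ω]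
    (P : Fin n → Measure X) (J : ℕ) (μ : Measure Ω) (ξ : Fin n → ℕ → ℕ → Ω → X) : Prop where
  measurable : ∀ i j r, j ≤ J → 1 ≤ r → Measurable (ξ i j r)
  law : ∀ i j r, j ≤ J → 1 ≤ r → μ.map (ξ i j r) = P i
  indep : iIndepFun
    (fun q : {q : Fin n × ℕ × ℕ // q.2.1 ≤ J ∧ 1 ≤ q.2.2} => ξ q.1.1 q.1.2.1 q.1.2.2) μ

/-- The hyperparameters: dual and primal step sizes, extrapolation weights and local step sizes. -/
structure Hyper where
  σ : ℕ → ℝ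
  τ : ℕ → ℝ
  ς : ℕ → ℝ
  η : ℕ → ℝ

/-- All hyperparameters are positive. -/
structure Hyper.Pos (H : Hyper) : Prop where
  σ_pos : ∀ r, 0 < H.σ r
  τ_pos : ∀ r, 0 < H.τ r
  ς_pos : ∀ r, 0 < H.ς r
  η_pos : ∀ r, 0 < H.η r

/-- Local iterates of one client: `u₀ = θ` and `uⱼ = uⱼ₋₁ - η (Gⱼ(uⱼ₋₁) - cᵢ + c)`, where `Gⱼ` is the
stochastic gradient field of step `j`. -/
def localIter {d : ℕ} (G : ℕ → Vec d → Vec d) (η : ℝ) (θ ci c : Vec d) : ℕ → Vec d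
  | 0 => θ
  | j + 1 => localIter G η θ ci c j - η • (G (j + 1) (localIter G η θ ci c j) - ci + c)

/-- Result `Δuᵢ = (θ - u_J) / (η J)` of the local stochastic update. -/
def localUpdate {d : ℕ} (G : ℕ → Vec d → Vec d) (η : ℝ) (J : ℕ) (θ ci c : Vec d) : Vec d :=
  (1 / (η * J)) • (θ - localIter G η θ ci c J)

/-- The direction `∑ᵢ λᵢ Δuᵢ` of one round at the model parameter `θ` with the new weight `l`, where
`G i j` is the stochastic gradient field of client `i` at local step `j`. The control variates are
`cᵢ = G i 0 θ` and `c = ∑ᵢ λᵢ cᵢ`. -/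
def roundDirection {d n : ℕ} (G : Fin n → ℕ → Vec d → Vec d) (η : ℝ) (J : ℕ)
    (θ : Vec d) (l : Vec n) : Vec d :=
  ∑ i, l i • localUpdate (G i) η J θ (G i 0 θ) (∑ k, l k • G k 0 θ)

/-- The direction `∑ᵢ λᵢʳ⁺¹ Δuᵢʳ` in round `r` at the outcome `ω`. -/
def direction {d n : ℕ} {X Ω : Type*} (g : Fin n → Vec d → X → ℝ) (J : ℕ) (H : Hyper)
    (ξ : Fin n → ℕ → ℕ → Ω → X) (θ : ℕ → Ω → Vec d) (l : ℕ → Ω → Vec n) (r : ℕ) (ω : Ω) : Vec d :=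
  roundDirection (fun i j x => sampleGrad (g i) x (ξ i j r ω)) (H.η r) J (θ r ω) (l (r + 1) ω)

/-- The extrapolated loss vector `sʳ = (1 + ςᵣ) Lʳ - ςᵣ Lʳ⁻¹`. -/
def extrapolated {d n : ℕ} {Ω : Type*} (f : Fin n → Vec d → ℝ) (H : Hyper)
    (θ : ℕ → Ω → Vec d) (r : ℕ) (ω : Ω) : Vec n :=
  (1 + H.ς r) • lossVec f (θ r ω) - H.ς r • lossVec f (θ (r - 1) ω)

/-- `(θ, l)` is a run of the algorithm for `R` rounds from `(θ₀, l₀)`. The minimizer over `A × B`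
need not be unique, and any choice of it is allowed. -/
structure IsRun {d n : ℕ} {X Ω : Type*} (f : Fin n → Vec d → ℝ) (g : Fin n → Vec d → X → ℝ)
    (Θ : Set (Vec d)) (A B : Set (Vec n)) (φ : ℝ) (J : ℕ) (H : Hyper)
    (ξ : Fin n → ℕ → ℕ → Ω → X) (R : ℕ) (θ₀ : Vec d) (l₀ : Vec n)
    (θ : ℕ → Ω → Vec d) (l : ℕ → Ω → Vec n) : Prop where
  primal_zero : ∀ ω, θ 0 ω = θ₀
  primal_one : ∀ ω, θ 1 ω = θ₀
  dual_zero : ∀ ω, l 0 ω = l₀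
  dual_one : ∀ ω, l 1 ω = l₀
  dual_step : ∀ r, 1 ≤ r → r ≤ R → ∀ ω, ∃ a ∈ A, ∃ b ∈ B,
    IsMinOn (fun q : Vec n × Vec n => -inner ℝ (extrapolated f H θ r ω) (combine φ q.1 q.2)
      + 1 / (2 * H.σ r) * ‖combine φ q.1 q.2 - l r ω‖ ^ 2) (A ×ˢ B) (a, b) ∧
    l (r + 1) ω = combine φ a b
  primal_step : ∀ r, 1 ≤ r → r ≤ R → ∀ ω, θ (r + 1) ω ∈ Θ ∧
    IsMinOn (fun x : Vec d => inner ℝ (direction g J H ξ θ l r ω) x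
      + 1 / (2 * H.τ r) * ‖x - θ r ω‖ ^ 2) Θ (θ (r + 1) ω)

/-- Almost surely, the unprojected primal step stays in `Θ` in each of the rounds `1, …, R`. -/
def NoProjection {d n : ℕ} {X Ω : Type*} [MeasurableSpace Ω] (g : Fin n → Vec d → X → ℝ)
    (Θ : Set (Vec d)) (J : ℕ) (H : Hyper) (ξ : Fin n → ℕ → ℕ → Ω → X) (μ : Measure Ω) (R : ℕ)
    (θ : ℕ → Ω → Vec d) (l : ℕ → Ω → Vec n) : Prop :=
  ∀ r, 1 ≤ r → r ≤ R → ∀ᵐ ω ∂μ, θ r ω - H.τ r • direction g J H ξ θ l r ω ∈ Θ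

end ScaffPDIA

end

namespace ScaffPDIA

/-! Weights in `Λ` sum to one and have `ℓ¹` norm at most `s = ‖Λ‖₁`, so their negative part has mass
at most `(s - 1) / 2`. Hence every `F(·, λ)` is strongly convex with modulus `μ = m - M * (s - 1) /
2`, and `s < 1 + 2 * m / M` says exactly that `μ > 0` (`objective_strong`). As `F` is linear in `λ`,
Sion's theorem gives a saddle point. Saddle points are interchangeable, so strong convexity forces a
single primal component.

For the rate, the direction of a round splits into the weighted gradient, a mean noise and a drift
of the local iterates (`roundDirection_eq`). Each stochastic gradient is taken at a point that does
not involve its own sample. The dual step uses exact losses, so the new weight is known before the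
round samples anything. The noise is therefore orthogonal in expectation to `θ r - θs`
(`integral_inner_meanNoise`). The drift is of order `η` times the direction plus noise
(`norm_drift_le`). Without projection, `τ` times the direction is the primal step itself, so for `η
= τ` the drift is absorbed by the squared step length. A bound by the gradient alone would not
suffice, because the gradient need not vanish at a constrained minimizer.

The descent inequality of a round (`round_descent`) is multiplied by `T = ρ + r`. With `τ = 1 / (β *
T)` and `μ = 4 * β`, the weight of `halfSqDist θs x` is `β * T ^ 2 - 2 * β * T ≤ β * (T - 1) ^ 2`,
so `potential` telescopes up to noise, and each round adds at most a constant times `δ ^ 2` in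
expectation. After `R` rounds the potential dominates `β * (ρ + R) ^ 2 / 2` times the squared
distance. Division leaves `δ ^ 2 / R` for the noise and `1 / R ^ 2` for the initial distances. -/

/-- The weighted gradient `∑ᵢ λᵢ ∇fᵢ(θ)`. -/
noncomputable def weightedGrad {d n : ℕ} (f : Fin n → Vec d → ℝ) (θ : Vec d) (l : Vec n) : Vec d :=
  ∑ i, l i • gradient (f i) θ

theorem objective_eq_inner {d n : ℕ} (f : Fin n → Vec d → ℝ) (θ : Vec d) (l : Vec n) :
    objective f θ l = inner ℝ (lossVec f θ) l := by
  simp [objective, lossVec, PiLp.inner_apply]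

theorem inner_weightedGrad {d n : ℕ} (f : Fin n → Vec d → ℝ) (θ : Vec d) (l : Vec n) (v : Vec d) :
    inner ℝ (weightedGrad f θ l) v = ∑ i, l i * inner ℝ (gradient (f i) θ) v := by
  simp [weightedGrad, sum_inner, real_inner_smul_left]

/-! ### The integrated set -/

theorem integratedSet_eq_image {n : ℕ} (φ : ℝ) (A B : Set (Vec n)) :
    integratedSet φ A B = (fun q : Vec n × Vec n => combine φ q.1 q.2) '' (A ×ˢ B) := by
  ext l
  constructor
  · rintro ⟨a, ha, b, hb, rfl⟩
    exact ⟨(a, b), ⟨ha, hb⟩, rfl⟩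
  · rintro ⟨q, ⟨ha, hb⟩, rfl⟩
    exact ⟨q.1, ha, q.2, hb, rfl⟩

theorem isCompact_integratedSet {n : ℕ} {φ : ℝ} {A B : Set (Vec n)} (hA : IsCompact A)
    (hB : IsCompact B) : IsCompact (integratedSet φ A B) := by
  rw [integratedSet_eq_image]
  refine (hA.prod hB).image ?_
  unfold combine
  fun_prop

theorem integratedSet_nonempty {n : ℕ} {φ : ℝ} {A B : Set (Vec n)} (hA : A.Nonempty)
    (hB : B.Nonempty) : (integratedSet φ A B).Nonempty := by
  rw [integratedSet_eq_image]
  exact (hA.prod hB).image _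

theorem sum_eq_one_of_mem_integratedSet {n : ℕ} {φ : ℝ} {A B : Set (Vec n)} (hφ : φ < 1)
    (hA : A ⊆ simplex n) (hB : B ⊆ simplex n) {l : Vec n} (hl : l ∈ integratedSet φ A B) :
    ∑ i, l i = 1 := by
  obtain ⟨a, ha, b, hb, rfl⟩ := hl
  have h : (1 - φ) ≠ 0 := by linarith
  simp only [combine, PiLp.smul_apply, PiLp.sub_apply, smul_eq_mul]
  rw [← Finset.mul_sum, Finset.sum_sub_distrib, ← Finset.mul_sum, (hA ha).2, (hB hb).2]
  field_simp

theorem sum_abs_le_l1Norm {n : ℕ} {C : Set (Vec n)} (hC : IsCompact C) {l : Vec n} (hl : l ∈ C) :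
    ∑ i, |l i| ≤ l1Norm C := by
  have hcont : Continuous fun c : Vec n => ∑ i, |c i| := by fun_prop
  exact le_csSup (hC.image hcont).bddAbove ⟨l, hl, rfl⟩

theorem one_le_sum_abs {n : ℕ} {l : Vec n} (hl : ∑ i, l i = 1) : 1 ≤ ∑ i, |l i| := by
  rw [← hl]
  exact Finset.sum_le_sum fun i _ => le_abs_self _

/-! ### Convexity and smoothness of the objective -/

namespace IsRegularLoss

variable {d n : ℕ} {f : Fin n → Vec d → ℝ} {m M : ℝ}

theorem continuous (hf : IsRegularLoss f m M) (i : Fin n) : Continuous (f i) :=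
  (hf.contDiff i).continuous

/-- Co-coercivity: at the point `x - g / M`, the lower bound based at `y` and the upper bound based
at `x` give `‖g‖ ^ 2 / (2 * M) ≤ M / 2 * ‖x - y‖ ^ 2`. -/
theorem norm_gradient_sub_le (hm : 0 < m) (hM : 0 < M) (hf : IsRegularLoss f m M) (i : Fin n)
    (x y : Vec d) : ‖gradient (f i) x - gradient (f i) y‖ ≤ M * ‖x - y‖ := by
  set g := gradient (f i) x - gradient (f i) y with hg
  have h1 := hf.strong i (x - (1 / M) • g) y
  have h2 := hf.smooth i (x - (1 / M) • g) x
  have h3 := hf.smooth i x y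
  have e1 : x - (1 / M) • g - y = (x - y) - (1 / M) • g := by abel
  have e2 : x - (1 / M) • g - x = -((1 / M) • g) := by abel
  rw [e1, inner_sub_right, real_inner_smul_right] at h1
  rw [e2, inner_neg_right, real_inner_smul_right, norm_neg, norm_smul, mul_pow] at h2
  have e3 : ‖g‖ ^ 2 = inner ℝ (gradient (f i) x) g - inner ℝ (gradient (f i) y) g := by
    rw [← inner_sub_left, ← hg, real_inner_self_eq_norm_sq]
  have e4 : M / 2 * (‖1 / M‖ ^ 2 * ‖g‖ ^ 2) = 1 / (2 * M) * ‖g‖ ^ 2 := by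
    rw [Real.norm_eq_abs, sq_abs]; field_simp
  have h5 : 0 ≤ m / 2 * ‖x - y - (1 / M) • g‖ ^ 2 := by positivity
  have h6 : 1 / (2 * M) * ‖g‖ ^ 2 ≤ M / 2 * ‖x - y‖ ^ 2 := by
    have : 1 / M * ‖g‖ ^ 2 = 2 * (1 / (2 * M) * ‖g‖ ^ 2) := by field_simp
    have h8 : 1 / M * ‖g‖ ^ 2 = 1 / M * inner ℝ (gradient (f i) x) g
        - 1 / M * inner ℝ (gradient (f i) y) g := by rw [e3, mul_sub]
    rw [e4] at h2
    linarith
  have h7 : ‖g‖ ^ 2 ≤ (M * ‖x - y‖) ^ 2 := by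
    have := mul_le_mul_of_nonneg_left h6 (by positivity : 0 ≤ 2 * M)
    calc ‖g‖ ^ 2 = 2 * M * (1 / (2 * M) * ‖g‖ ^ 2) := by field_simp
      _ ≤ 2 * M * (M / 2 * ‖x - y‖ ^ 2) := this
      _ = (M * ‖x - y‖) ^ 2 := by ring
  exact le_of_sq_le_sq h7 (by positivity)

theorem continuous_gradient (hm : 0 < m) (hM : 0 < M) (hf : IsRegularLoss f m M) (i : Fin n) :
    Continuous (gradient (f i)) := by
  have : LipschitzWith M.toNNReal (gradient (f i)) := LipschitzWith.of_dist_le_mul fun x y => by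
    rw [dist_eq_norm, dist_eq_norm, Real.coe_toNNReal _ hM.le]
    exact hf.norm_gradient_sub_le hm hM i x y
  exact this.continuous

theorem objective_sub_eq (x y : Vec d) (l : Vec n) :
    objective f x l - objective f y l - inner ℝ (weightedGrad f y l) (x - y)
      = ∑ i, l i * (f i x - f i y - inner ℝ (gradient (f i) y) (x - y)) := by
  rw [inner_weightedGrad, objective, objective, ← Finset.sum_sub_distrib, ← Finset.sum_sub_distrib]
  exact Finset.sum_congr rfl fun i _ => by ring

theorem objective_smooth (hm : 0 < m) (hM : 0 < M) (hf : IsRegularLoss f m M) {s : ℝ} {l : Vec n}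
    (hs : ∑ i, |l i| ≤ s) (x y : Vec d) :
    objective f x l - objective f y l - inner ℝ (weightedGrad f y l) (x - y)
      ≤ s * M / 2 * ‖x - y‖ ^ 2 := by
  rw [objective_sub_eq]
  have h0 : 0 ≤ M / 2 * ‖x - y‖ ^ 2 := by positivity
  calc _ ≤ ∑ i, |l i| * (M / 2 * ‖x - y‖ ^ 2) := by
        refine Finset.sum_le_sum fun i _ => ?_
        have h1 := hf.strong i x y
        have h2 : 0 ≤ m / 2 * ‖x - y‖ ^ 2 := by positivity
        exact mul_le_mul (le_abs_self _) (hf.smooth i x y) (h2.trans h1) (abs_nonneg _)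
    _ ≤ s * (M / 2 * ‖x - y‖ ^ 2) := by
        rw [← Finset.sum_mul]; exact mul_le_mul_of_nonneg_right hs h0
    _ = _ := by ring

/-- The positive weights have mass `(∑ |l i| + 1) / 2 ≥ 1` and each unit contributes curvature at
least `m`; the negative weights have mass at most `(s - 1) / 2` and each unit costs at most `M`. -/
theorem objective_strong (hm : 0 < m) (hM : 0 < M) (hf : IsRegularLoss f m M) {s : ℝ} {l : Vec n}
    (hs : ∑ i, |l i| ≤ s) (hl : ∑ i, l i = 1) (x y : Vec d) :
    (m - M * (s - 1) / 2) / 2 * ‖x - y‖ ^ 2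
      ≤ objective f x l - objective f y l - inner ℝ (weightedGrad f y l) (x - y) := by
  rw [objective_sub_eq]
  set q := ‖x - y‖ ^ 2 with hq
  have hq0 : 0 ≤ q := by positivity
  have key : ∀ i, (m * ((|l i| + l i) / 2) - M * ((|l i| - l i) / 2)) / 2 * q
      ≤ l i * (f i x - f i y - inner ℝ (gradient (f i) y) (x - y)) := by
    intro i
    have h1 := hf.strong i x y
    have h2 := hf.smooth i x y
    rcases le_total 0 (l i) with h | h
    · rw [abs_of_nonneg h]; nlinarith [mul_le_mul_of_nonneg_left h1 h]
    · rw [abs_of_nonpos h]; nlinarith [mul_le_mul_of_nonpos_left h2 h]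
  refine le_trans ?_ (Finset.sum_le_sum fun i _ => key i)
  rw [← Finset.sum_mul, ← Finset.sum_div, Finset.sum_sub_distrib, ← Finset.mul_sum,
    ← Finset.mul_sum, ← Finset.sum_div, ← Finset.sum_div, Finset.sum_add_distrib,
    Finset.sum_sub_distrib, hl]
  refine mul_le_mul_of_nonneg_right ?_ hq0
  have := one_le_sum_abs hl
  nlinarith

theorem objective_convex_comb_le (hm : 0 < m) (hM : 0 < M) (hf : IsRegularLoss f m M) {s : ℝ} {l : Vec n}
    (hs : ∑ i, |l i| ≤ s) (hl : ∑ i, l i = 1) {a b : ℝ} (ha : 0 ≤ a) (hb : 0 ≤ b)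
    (hab : a + b = 1) (x y : Vec d) :
    objective f (a • x + b • y) l + (m - M * (s - 1) / 2) / 2 * (a * b) * ‖x - y‖ ^ 2
      ≤ a * objective f x l + b * objective f y l := by
  have h1 := hf.objective_strong hm hM hs hl x (a • x + b • y)
  have h2 := hf.objective_strong hm hM hs hl y (a • x + b • y)
  have e1 : x - (a • x + b • y) = b • (x - y) := by
    rw [show a = 1 - b by linarith]; module
  have e2 : y - (a • x + b • y) = (-a) • (x - y) := by
    rw [show b = 1 - a by linarith]; module
  rw [e1, norm_smul, mul_pow, real_inner_smul_right, Real.norm_eq_abs, sq_abs] at h1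
  rw [e2, norm_smul, mul_pow, real_inner_smul_right, Real.norm_eq_abs, sq_abs] at h2
  have h3 := mul_le_mul_of_nonneg_left h1 ha
  have h4 := mul_le_mul_of_nonneg_left h2 hb
  obtain rfl : a = 1 - b := by linarith
  nlinarith

end IsRegularLoss

theorem continuous_objective {d n : ℕ} {f : Fin n → Vec d → ℝ} (hf : ∀ i, Continuous (f i)) :
    Continuous fun p : Vec d × Vec n => objective f p.1 p.2 := by
  unfold objective
  fun_prop

theorem objective_add_smul {d n : ℕ} (f : Fin n → Vec d → ℝ) (θ : Vec d) (a b : ℝ) (l l' : Vec n) :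
    objective f θ (a • l + b • l') = a * objective f θ l + b * objective f θ l' := by
  simp only [objective_eq_inner, inner_add_right, real_inner_smul_right]

/-! ### Saddle points -/

section Saddle

variable {d n : ℕ} {f : Fin n → Vec d → ℝ} {m M s : ℝ} {Θ : Set (Vec d)} {Λ : Set (Vec n)}

theorem isSolution_of_saddle (hf : ∀ i, Continuous (f i)) (hΛ : IsCompact Λ) {p : Vec d × Vec n}
    (h1 : p.1 ∈ Θ) (h2 : p.2 ∈ Λ) (h3 : ∀ l ∈ Λ, objective f p.1 l ≤ objective f p.1 p.2)
    (h4 : ∀ θ ∈ Θ, objective f p.1 p.2 ≤ objective f θ p.2) : IsSolution f Θ Λ p := by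
  refine ⟨h1, h2, ⟨⟨p.1, h1, ?_⟩, ?_⟩, h3, h4⟩
  · refine le_antisymm (csSup_le ⟨_, p.2, h2, rfl⟩ ?_) (le_csSup ⟨objective f p.1 p.2, ?_⟩ ⟨p.2, h2, rfl⟩)
    · rintro _ ⟨l, hl, rfl⟩
      exact h3 l hl
    · rintro _ ⟨l, hl, rfl⟩
      exact h3 l hl
  · rintro _ ⟨θ, hθ, rfl⟩
    have hc : Continuous (objective f θ) :=
      (continuous_objective hf).comp (Continuous.prodMk_right θ)
    exact (h4 θ hθ).trans (le_csSup (hΛ.image hc).bddAbove ⟨p.2, h2, rfl⟩)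

theorem exists_isSolution (hm : 0 < m) (hM : 0 < M) (hf : IsRegularLoss f m M)
    (hμ : 0 ≤ m - M * (s - 1) / 2) (hs : ∀ l ∈ Λ, ∑ i, |l i| ≤ s) (hl : ∀ l ∈ Λ, ∑ i, l i = 1)
    (hΘ_ne : Θ.Nonempty) (hΘ : IsCompact Θ) (hΘ_conv : Convex ℝ Θ)
    (hΛ_ne : Λ.Nonempty) (hΛ : IsCompact Λ) (hΛ_conv : Convex ℝ Λ) :
    ∃ p, IsSolution f Θ Λ p := by
  have hc := continuous_objective hf.continuous
  obtain ⟨θ, hθ, l, hlΛ, h⟩ := Sion.exists_isSaddlePointOn (f := objective f) hΘ_ne hΘ_conv hΘ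
    (fun l _ => (hc.comp (Continuous.prodMk_left l)).lowerSemicontinuous.lowerSemicontinuousOn _)
    (fun l hlΛ => ConvexOn.quasiconvexOn ⟨hΘ_conv, fun x _ y _ a b ha hb hab => by
      have h1 := hf.objective_convex_comb_le hm hM (hs l hlΛ) (hl l hlΛ) ha hb hab x y
      have h2 : 0 ≤ (m - M * (s - 1) / 2) / 2 * (a * b) * ‖x - y‖ ^ 2 := by positivity
      simp only [smul_eq_mul]
      linarith⟩)
    hΛ_conv hΛ_ne hΛ
    (fun θ _ => (hc.comp (Continuous.prodMk_right θ)).upperSemicontinuous.upperSemicontinuousOn _)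
    (fun θ _ => ConcaveOn.quasiconcaveOn ⟨hΛ_conv, fun x _ y _ a b _ _ _ =>
      (objective_add_smul f θ a b x y).ge⟩)
  exact ⟨(θ, l), isSolution_of_saddle hf.continuous hΛ hθ hlΛ (fun l' hl' => h θ hθ l' hl')
    fun θ' hθ' => h θ' hθ' l hlΛ⟩

/-- The four saddle inequalities form a cycle `F(p₁, q₂) ≤ F(p₁, p₂) ≤ F(q₁, p₂) ≤ F(q₁, q₂) ≤ F(p₁,
q₂)`. -/
theorem IsSolution.objective_eq {p q : Vec d × Vec n} (hp : IsSolution f Θ Λ p)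
    (hq : IsSolution f Θ Λ q) : objective f p.1 q.2 = objective f q.1 q.2 := by
  have h1 := hp.dual_le q.2 hq.mem_dual
  have h2 := hp.le_primal q.1 hq.mem_primal
  have h3 := hq.dual_le p.2 hp.mem_dual
  have h4 := hq.le_primal p.1 hp.mem_primal
  linarith

/-- Both primal components minimize `F(·, q.2)` by interchangeability; at distinct minimizers,
strong convexity would make the midpoint strictly better. -/
theorem IsSolution.fst_eq (hm : 0 < m) (hM : 0 < M) (hf : IsRegularLoss f m M)
    (hμ : 0 < m - M * (s - 1) / 2) (hs : ∀ l ∈ Λ, ∑ i, |l i| ≤ s) (hl : ∀ l ∈ Λ, ∑ i, l i = 1)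
    (hΘ_conv : Convex ℝ Θ) {p q : Vec d × Vec n} (hp : IsSolution f Θ Λ p)
    (hq : IsSolution f Θ Λ q) : p.1 = q.1 := by
  have h0 := hp.objective_eq hq
  have h1 := hf.objective_convex_comb_le hm hM (hs _ hq.mem_dual) (hl _ hq.mem_dual)
    (a := 1 / 2) (b := 1 / 2) (by norm_num) (by norm_num) (by norm_num) p.1 q.1
  have h2 := hq.le_primal _ (hΘ_conv hp.mem_primal hq.mem_primal
    (by norm_num : (0 : ℝ) ≤ 1 / 2) (by norm_num : (0 : ℝ) ≤ 1 / 2) (by norm_num))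
  have h3 : (m - M * (s - 1) / 2) / 2 * (1 / 2 * (1 / 2)) * ‖p.1 - q.1‖ ^ 2 ≤ 0 := by linarith
  have h4 : ‖p.1 - q.1‖ ^ 2 ≤ 0 := by
    by_contra h
    push Not at h
    have : 0 < (m - M * (s - 1) / 2) / 2 * (1 / 2 * (1 / 2)) * ‖p.1 - q.1‖ ^ 2 := by positivity
    linarith
  have h5 : ‖p.1 - q.1‖ = 0 := by nlinarith [norm_nonneg (p.1 - q.1)]
  exact sub_eq_zero.mp (norm_eq_zero.mp h5)

/-- The solution set is a product with a unique primal factor. -/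
theorem exists_solutionSet_eq (hm : 0 < m) (hM : 0 < M) (hf : IsRegularLoss f m M)
    (hμ : 0 < m - M * (s - 1) / 2) (hs : ∀ l ∈ Λ, ∑ i, |l i| ≤ s) (hl : ∀ l ∈ Λ, ∑ i, l i = 1)
    (hΘ_ne : Θ.Nonempty) (hΘ : IsCompact Θ) (hΘ_conv : Convex ℝ Θ)
    (hΛ_ne : Λ.Nonempty) (hΛ : IsCompact Λ) (hΛ_conv : Convex ℝ Λ) :
    ∃ θs ∈ Θ, ∃ Λs ⊆ Λ, Λs.Nonempty ∧ {p | IsSolution f Θ Λ p} = {θs} ×ˢ Λs := by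
  obtain ⟨p, hp⟩ := exists_isSolution hm hM hf hμ.le hs hl hΘ_ne hΘ hΘ_conv hΛ_ne hΛ hΛ_conv
  refine ⟨p.1, hp.mem_primal, {l | IsSolution f Θ Λ (p.1, l)}, fun l h => h.mem_dual,
    ⟨p.2, hp⟩, ?_⟩
  ext ⟨θ, l⟩
  simp only [Set.mem_ofPred_eq, Set.mem_prod, Set.mem_singleton_iff]
  constructor
  · intro h
    have : θ = p.1 := h.fst_eq hm hM hf hμ hs hl hΘ_conv hp
    exact ⟨this, this ▸ h⟩
  · rintro ⟨rfl, h⟩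
    exact h

end Saddle

/-! ### Projections onto convex sets -/

section Projection

variable {E : Type*} [NormedAddCommGroup E] [InnerProductSpace ℝ E]

/-- The variational inequality of a proximal step. -/
theorem IsMinOn.inner_prox_le {C : Set E} (hC : Convex ℝ C) {v x y : E} {τ : ℝ} (hτ : 0 < τ)
    (hy : y ∈ C) (h : IsMinOn (fun z => inner ℝ v z + 1 / (2 * τ) * ‖z - x‖ ^ 2) C y) {z : E}
    (hz : z ∈ C) : inner ℝ (x - τ • v - y) (z - y) ≤ 0 := by
  -- Minimality is tested at `y + t • (z - y)`; after division by `t` the error is of order `t`, and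
  -- `t → 0` finishes the proof.
  have key : ∀ t : ℝ, 0 < t → t ≤ 1 →
      inner ℝ (x - τ • v - y) (z - y) ≤ t * (‖z - y‖ ^ 2 / 2) := by
    intro t ht ht1
    have hmem : y + t • (z - y) ∈ C := by
      have := hC hy hz (by linarith : 0 ≤ 1 - t) ht.le (by ring)
      convert this using 1
      module
    have h1 := isMinOn_iff.mp h _ hmem
    have e : y + t • (z - y) - x = (y - x) + t • (z - y) := by abel
    rw [e, @norm_add_sq_real, inner_add_right, real_inner_smul_right, norm_smul,
      real_inner_smul_right, mul_pow, Real.norm_eq_abs, sq_abs] at h1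
    have h2 : 0 ≤ t * (inner ℝ v (z - y)
        + 1 / (2 * τ) * (2 * inner ℝ (y - x) (z - y) + t * ‖z - y‖ ^ 2)) := by linarith
    have h3 := nonneg_of_mul_nonneg_right h2 ht
    have h4 := mul_nonneg hτ.le h3
    have e2 : τ * (inner ℝ v (z - y)
        + 1 / (2 * τ) * (2 * inner ℝ (y - x) (z - y) + t * ‖z - y‖ ^ 2))
        = τ * inner ℝ v (z - y) + inner ℝ (y - x) (z - y) + t * (‖z - y‖ ^ 2 / 2) := by
      field_simp
      ring
    have e3 : x - τ • v - y = -(y - x) - τ • v := by abel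
    rw [e3, inner_sub_left, inner_neg_left, real_inner_smul_left]
    linarith
  refine le_of_forall_pos_le_add fun ε hε => ?_
  have hq : 0 ≤ ‖z - y‖ ^ 2 / 2 := by positivity
  have h5 := key (min 1 (ε / (‖z - y‖ ^ 2 / 2 + 1))) (lt_min one_pos (by positivity))
    (min_le_left _ _)
  have h6 : min 1 (ε / (‖z - y‖ ^ 2 / 2 + 1)) * (‖z - y‖ ^ 2 / 2) ≤ ε := by
    calc _ ≤ ε / (‖z - y‖ ^ 2 / 2 + 1) * (‖z - y‖ ^ 2 / 2) :=
          mul_le_mul_of_nonneg_right (min_le_right _ _) hq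
      _ ≤ ε := by
          rw [div_mul_eq_mul_div, div_le_iff₀ (by positivity)]
          nlinarith
  linarith

open Classical in
/-- The nearest point of `C` to `x`, characterized by its variational inequality. -/
noncomputable def nearest (C : Set E) (x : E) : E :=
  if h : ∃ y ∈ C, ∀ z ∈ C, inner ℝ (x - y) (z - y) ≤ 0 then h.choose else x

theorem nearest_spec {C : Set E} (hne : C.Nonempty) (hcl : IsComplete C) (hC : Convex ℝ C) (x : E) :
    nearest C x ∈ C ∧ ∀ z ∈ C, inner ℝ (x - nearest C x) (z - nearest C x) ≤ 0 := by
  have h : ∃ y ∈ C, ∀ z ∈ C, inner ℝ (x - y) (z - y) ≤ 0 := by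
    obtain ⟨y, hy, h⟩ := exists_norm_eq_iInf_of_complete_convex hne hcl hC x
    exact ⟨y, hy, (norm_eq_iInf_iff_real_inner_le_zero hC hy).mp h⟩
  rw [nearest, dif_pos h]
  exact h.choose_spec

theorem norm_sub_le_of_variational {C : Set E} {x x' y y' : E} (hy : y ∈ C) (hy' : y' ∈ C)
    (h : ∀ z ∈ C, inner ℝ (x - y) (z - y) ≤ 0) (h' : ∀ z ∈ C, inner ℝ (x' - y') (z - y') ≤ 0) :
    ‖y - y'‖ ≤ ‖x - x'‖ := by
  have h1 := h y' hy'
  have h2 := h' y hy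
  have e : ‖y - y'‖ ^ 2 = inner ℝ (x - x') (y - y') + inner ℝ (x - y) (y' - y)
      + inner ℝ (x' - y') (y - y') := by
    rw [← neg_sub y y', inner_neg_right, ← real_inner_self_eq_norm_sq, ← sub_eq_add_neg,
      ← inner_sub_left, ← inner_add_left]
    congr 1
    abel
  have h3 := real_inner_le_norm (x - x') (y - y')
  rcases (norm_nonneg (y - y')).eq_or_lt with h0 | h0
  · rw [← h0]; exact norm_nonneg _
  · nlinarith

/-- This makes iterates measurable: however the minimizers are selected, they are values of one
continuous map. -/
theorem eq_nearest {C : Set E} (hne : C.Nonempty) (hcl : IsComplete C) (hC : Convex ℝ C) {x y : E}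
    (hy : y ∈ C) (h : ∀ z ∈ C, inner ℝ (x - y) (z - y) ≤ 0) : y = nearest C x := by
  obtain ⟨h1, h2⟩ := nearest_spec hne hcl hC x
  have := norm_sub_le_of_variational hy h1 h h2
  rw [sub_self, norm_zero, norm_le_zero_iff] at this
  exact sub_eq_zero.mp this

theorem continuous_nearest {C : Set E} (hne : C.Nonempty) (hcl : IsComplete C) (hC : Convex ℝ C) :
    Continuous (nearest C) := by
  have : LipschitzWith 1 (nearest C) := LipschitzWith.of_dist_le_mul fun x y => by
    rw [dist_eq_norm, dist_eq_norm, NNReal.coe_one, one_mul]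
    obtain ⟨h1, h2⟩ := nearest_spec hne hcl hC x
    obtain ⟨h3, h4⟩ := nearest_spec hne hcl hC y
    exact norm_sub_le_of_variational h1 h3 h2 h4
  exact this.continuous

/-- The three-point inequality of a proximal step. -/
theorem inner_sub_le_of_variational {C : Set E} {v x y z : E} {τ : ℝ} (hτ : 0 < τ)
    (h : ∀ z ∈ C, inner ℝ (x - τ • v - y) (z - y) ≤ 0) (hz : z ∈ C) :
    inner ℝ v (y - z) ≤ 1 / τ * (‖z - x‖ ^ 2 / 2 - ‖z - y‖ ^ 2 / 2 - ‖y - x‖ ^ 2 / 2) := by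
  have h1 := h z hz
  have e0 : x - τ • v - y = (x - y) - τ • v := by abel
  rw [e0, inner_sub_left, real_inner_smul_left] at h1
  have e1 : z - x = (z - y) - (x - y) := by abel
  have e2 : ‖z - x‖ ^ 2 = ‖z - y‖ ^ 2 - 2 * inner ℝ (x - y) (z - y) + ‖y - x‖ ^ 2 := by
    rw [e1, @norm_sub_sq_real, real_inner_comm, norm_sub_rev y x]
  have e3 : inner ℝ v (y - z) = -inner ℝ v (z - y) := by rw [← inner_neg_right, neg_sub]
  rw [e2, e3]
  calc -inner ℝ v (z - y) = 1 / τ * (-(τ * inner ℝ v (z - y))) := by field_simp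
    _ ≤ 1 / τ * (-inner ℝ (x - y) (z - y)) :=
        mul_le_mul_of_nonneg_left (by linarith) (by positivity)
    _ = _ := by ring

end Projection

/-! ### The direction of one round -/

section Direction

variable {d n : ℕ}

/-- The point at which client `i` queries its `j`-th stochastic gradient: the model parameter for
the control variate `j = 0`, and the local iterate `u_{j-1}` for `j ≥ 1`. -/
def queryPoint (G : Fin n → ℕ → Vec d → Vec d) (η : ℝ) (θ : Vec d) (l : Vec n) (i : Fin n) :
    ℕ → Vec d
  | 0 => θ
  | j + 1 => localIter (G i) η θ (G i 0 θ) (∑ k, l k • G k 0 θ) j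

/-- The error of the `j`-th stochastic gradient of client `i`. -/
noncomputable def roundNoise (f : Fin n → Vec d → ℝ) (G : Fin n → ℕ → Vec d → Vec d) (η : ℝ)
    (θ : Vec d) (l : Vec n) (i : Fin n) (j : ℕ) : Vec d :=
  G i j (queryPoint G η θ l i j) - gradient (f i) (queryPoint G η θ l i j)

/-- The sum of the norms of all errors of one round. -/
noncomputable def totalNoise (f : Fin n → Vec d → ℝ) (G : Fin n → ℕ → Vec d → Vec d) (η : ℝ)
    (J : ℕ) (θ : Vec d) (l : Vec n) : ℝ :=
  ∑ i, ∑ j ∈ Finset.range (J + 1), ‖roundNoise f G η θ l i j‖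

/-- The weighted average of the errors of the local steps. -/
noncomputable def meanNoise (f : Fin n → Vec d → ℝ) (G : Fin n → ℕ → Vec d → Vec d) (η : ℝ)
    (J : ℕ) (θ : Vec d) (l : Vec n) : Vec d :=
  ∑ i, l i • (1 / (J : ℝ)) • ∑ j ∈ Finset.range J, roundNoise f G η θ l i (j + 1)

/-- The bias of the direction caused by the drift of the local iterates. -/
noncomputable def drift (f : Fin n → Vec d → ℝ) (G : Fin n → ℕ → Vec d → Vec d) (η : ℝ)
    (J : ℕ) (θ : Vec d) (l : Vec n) : Vec d :=
  ∑ i, l i • (1 / (J : ℝ)) • ∑ j ∈ Finset.range J,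
    (gradient (f i) (queryPoint G η θ l i (j + 1)) - gradient (f i) θ)

theorem sub_localIter (G : ℕ → Vec d → Vec d) (η : ℝ) (θ ci c : Vec d) (J : ℕ) :
    θ - localIter G η θ ci c J
      = η • ∑ j ∈ Finset.range J, (G (j + 1) (localIter G η θ ci c j) - ci + c) := by
  induction J with
  | zero => simp [localIter]
  | succ J ih =>
    rw [Finset.sum_range_succ, smul_add, ← ih, localIter]
    abel

theorem localUpdate_eq (G : ℕ → Vec d → Vec d) {η : ℝ} (hη : 0 < η) {J : ℕ} (hJ : 1 ≤ J)
    (θ ci c : Vec d) : localUpdate G η J θ ci c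
      = (1 / (J : ℝ)) • ∑ j ∈ Finset.range J, G (j + 1) (localIter G η θ ci c j) - ci + c := by
  have hJ' : (J : ℝ) ≠ 0 := by positivity
  rw [localUpdate, sub_localIter, smul_smul]
  have : 1 / (η * J) * η = 1 / (J : ℝ) := by field_simp
  rw [this, Finset.sum_add_distrib, Finset.sum_sub_distrib, Finset.sum_const, Finset.sum_const,
    Finset.card_range, ← Nat.cast_smul_eq_nsmul ℝ, ← Nat.cast_smul_eq_nsmul ℝ, smul_add, smul_sub,
    smul_smul, smul_smul, one_div, inv_mul_cancel₀ hJ', one_smul, one_smul]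

variable (f : Fin n → Vec d → ℝ) (G : Fin n → ℕ → Vec d → Vec d) {η : ℝ} {J : ℕ} (θ : Vec d)
  {l : Vec n}

/-- Since the weights sum to one, the control variates cancel: `∑ i, l i • (c - c_i) = 0`. -/
theorem roundDirection_eq (hη : 0 < η) (hJ : 1 ≤ J) (hl : ∑ i, l i = 1) :
    roundDirection G η J θ l
      = weightedGrad f θ l + meanNoise f G η J θ l + drift f G η J θ l := by
  have hJ' : (J : ℝ) ≠ 0 := by positivity
  have h1 : roundDirection G η J θ l
      = ∑ i, l i • (1 / (J : ℝ)) • ∑ j ∈ Finset.range J, G i (j + 1) (queryPoint G η θ l i (j + 1)) := by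
    unfold roundDirection
    simp_rw [localUpdate_eq _ hη hJ, smul_add, smul_sub]
    rw [Finset.sum_add_distrib, Finset.sum_sub_distrib, ← Finset.sum_smul, hl, one_smul]
    simp [queryPoint]
  rw [h1, weightedGrad, meanNoise, drift, ← Finset.sum_add_distrib, ← Finset.sum_add_distrib]
  refine Finset.sum_congr rfl fun i _ => ?_
  rw [← smul_add, ← smul_add]
  congr 1
  have h2 : gradient (f i) θ = (1 / (J : ℝ)) • ∑ j ∈ Finset.range J, gradient (f i) θ := by
    rw [Finset.sum_const, Finset.card_range, ← Nat.cast_smul_eq_nsmul ℝ, smul_smul, one_div,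
      inv_mul_cancel₀ hJ', one_smul]
  nth_rewrite 1 [h2]
  rw [← smul_add, ← smul_add, ← Finset.sum_add_distrib, ← Finset.sum_add_distrib]
  congr 1
  refine Finset.sum_congr rfl fun j _ => ?_
  rw [roundNoise]
  abel

theorem norm_weighted_average_le {s C : ℝ} (hs : ∑ i, |l i| ≤ s) (hJ : 1 ≤ J) (hC : 0 ≤ C)
    {v : Fin n → ℕ → Vec d} (hv : ∀ i, ∀ j < J, ‖v i j‖ ≤ C) :
    ‖∑ i, l i • (1 / (J : ℝ)) • ∑ j ∈ Finset.range J, v i j‖ ≤ s * C := by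
  have hJ' : (J : ℝ) ≠ 0 := by positivity
  have h1 : ∀ i, ‖(1 / (J : ℝ)) • ∑ j ∈ Finset.range J, v i j‖ ≤ C := by
    intro i
    have h2 : ‖∑ j ∈ Finset.range J, v i j‖ ≤ J * C := by
      refine (norm_sum_le_of_le _ fun j hj => hv i j (Finset.mem_range.mp hj)).trans ?_
      simp
    rw [norm_smul, Real.norm_of_nonneg (by positivity)]
    calc _ ≤ 1 / (J : ℝ) * (J * C) := by gcongr
      _ = C := by field_simp
  calc _ ≤ ∑ i, |l i| * C := by
        refine norm_sum_le_of_le _ fun i _ => ?_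
        rw [norm_smul, Real.norm_eq_abs]
        exact mul_le_mul_of_nonneg_left (h1 i) (abs_nonneg _)
    _ ≤ s * C := by
        rw [← Finset.sum_mul]
        exact mul_le_mul_of_nonneg_right hs hC

theorem totalNoise_nonneg : 0 ≤ totalNoise f G η J θ l :=
  Finset.sum_nonneg fun _ _ => Finset.sum_nonneg fun _ _ => norm_nonneg _

theorem norm_roundNoise_le (i : Fin n) {j : ℕ} (hj : j ≤ J) :
    ‖roundNoise f G η θ l i j‖ ≤ totalNoise f G η J θ l := by
  refine le_trans ?_ (Finset.single_le_sum (f := fun i => ∑ j ∈ Finset.range (J + 1),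
    ‖roundNoise f G η θ l i j‖) (fun i _ => Finset.sum_nonneg fun _ _ => norm_nonneg _)
    (Finset.mem_univ i))
  exact Finset.single_le_sum (f := fun j => ‖roundNoise f G η θ l i j‖)
    (fun _ _ => norm_nonneg _) (Finset.mem_range.mpr (by omega))

theorem norm_meanNoise_le {s : ℝ} (hs : ∑ i, |l i| ≤ s) (hJ : 1 ≤ J) :
    ‖meanNoise f G η J θ l‖ ≤ s * totalNoise f G η J θ l :=
  norm_weighted_average_le hs hJ (totalNoise_nonneg f G θ)
    fun i _ hj => norm_roundNoise_le f G θ i (by omega)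

variable {f}

/-- The distance `e_j` to `θ` satisfies `e_(j+1) ≤ (1 + η * M) * e_j + η * W ≤ 2 * e_j + η * W`,
solved by `(2 ^ j - 1) * η * W`. In `W`, the term `2 * Z` comes from the errors of the step and of
the client's control variate, and `s * Z` from the error of the averaged one. -/
theorem norm_queryPoint_sub_le {m M s : ℝ} (hm : 0 < m) (hM : 0 < M) (hf : IsRegularLoss f m M)
    (hη : 0 < η) (hηM : η * M ≤ 1) (hs : ∑ i, |l i| ≤ s) (i : Fin n) {j : ℕ} (hj : j ≤ J) :
    ‖queryPoint G η θ l i (j + 1) - θ‖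
      ≤ (2 ^ j - 1) * (η * ((2 + s) * totalNoise f G η J θ l + ‖weightedGrad f θ l‖)) := by
  set Z := totalNoise f G η J θ l with hZ
  have hZ0 : 0 ≤ Z := totalNoise_nonneg f G θ
  set W := (2 + s) * Z + ‖weightedGrad f θ l‖ with hW
  have hc : ‖∑ k, l k • G k 0 θ - weightedGrad f θ l‖ ≤ s * Z := by
    rw [weightedGrad, ← Finset.sum_sub_distrib]
    calc _ ≤ ∑ i, |l i| * Z := by
          refine norm_sum_le_of_le _ fun i _ => ?_
          rw [← smul_sub, norm_smul, Real.norm_eq_abs]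
          exact mul_le_mul_of_nonneg_left (norm_roundNoise_le f G θ i (Nat.zero_le J))
            (abs_nonneg _)
      _ ≤ s * Z := by
          rw [← Finset.sum_mul]
          exact mul_le_mul_of_nonneg_right hs hZ0
  induction j with
  | zero => simp [queryPoint, localIter]
  | succ j ih =>
    have ih := ih (by omega)
    set u := queryPoint G η θ l i (j + 1) with hu
    have hstep : queryPoint G η θ l i (j + 2) - θ = (u - θ)
        - η • (roundNoise f G η θ l i (j + 1) + (gradient (f i) u - gradient (f i) θ)
          - roundNoise f G η θ l i 0 + (∑ k, l k • G k 0 θ - weightedGrad f θ l)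
          + weightedGrad f θ l) := by
      have e1 : queryPoint G η θ l i (j + 2)
          = u - η • (G i (j + 1) u - G i 0 θ + ∑ k, l k • G k 0 θ) := rfl
      have e2 : roundNoise f G η θ l i (j + 1) = G i (j + 1) u - gradient (f i) u := rfl
      have e3 : roundNoise f G η θ l i 0 = G i 0 θ - gradient (f i) θ := rfl
      rw [e1, e2, e3]
      module
    have h1 := norm_roundNoise_le f G (η := η) (l := l) θ i (j := j + 1) hj
    have h2 := norm_roundNoise_le f G (η := η) (l := l) θ i (Nat.zero_le J)
    rw [← hZ] at h1 h2
    have h3 := hf.norm_gradient_sub_le hm hM i u θ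
    have h4 : ‖roundNoise f G η θ l i (j + 1) + (gradient (f i) u - gradient (f i) θ)
          - roundNoise f G η θ l i 0 + (∑ k, l k • G k 0 θ - weightedGrad f θ l)
          + weightedGrad f θ l‖ ≤ W + M * ‖u - θ‖ := by
      refine (norm_add_le _ _).trans ?_
      have a1 := norm_add_le (roundNoise f G η θ l i (j + 1)
        + (gradient (f i) u - gradient (f i) θ) - roundNoise f G η θ l i 0)
        (∑ k, l k • G k 0 θ - weightedGrad f θ l)
      have a2 := norm_sub_le (roundNoise f G η θ l i (j + 1)
        + (gradient (f i) u - gradient (f i) θ)) (roundNoise f G η θ l i 0)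
      have a3 := norm_add_le (roundNoise f G η θ l i (j + 1))
        (gradient (f i) u - gradient (f i) θ)
      rw [hW]
      linarith
    have h5 : η * M * ‖u - θ‖ ≤ ‖u - θ‖ := mul_le_of_le_one_left (norm_nonneg _) hηM
    rw [hstep]
    refine (norm_sub_le _ _).trans ?_
    rw [norm_smul, Real.norm_of_nonneg hη.le]
    have h6 := mul_le_mul_of_nonneg_left h4 hη.le
    rw [pow_succ]
    nlinarith

theorem norm_drift_le_of_weightedGrad {m M s : ℝ} (hm : 0 < m) (hM : 0 < M) (hf : IsRegularLoss f m M)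
    (hη : 0 < η) (hηM : η * M ≤ 1) (hs : ∑ i, |l i| ≤ s) (hs0 : 0 ≤ s) (hJ : 1 ≤ J) :
    ‖drift f G η J θ l‖ ≤ s * M * 2 ^ J * η
      * ((2 + s) * totalNoise f G η J θ l + ‖weightedGrad f θ l‖) := by
  have hZ0 : 0 ≤ totalNoise f G η J θ l := totalNoise_nonneg f G θ
  set W := (2 + s) * totalNoise f G η J θ l + ‖weightedGrad f θ l‖ with hW
  have hW0 : 0 ≤ W := by positivity
  have h := norm_weighted_average_le (C := M * (2 ^ J * (η * W))) hs hJ (by positivity)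
    (v := fun i j => gradient (f i) (queryPoint G η θ l i (j + 1)) - gradient (f i) θ)
    fun i j hj => by
      refine (hf.norm_gradient_sub_le hm hM i _ _).trans ?_
      refine mul_le_mul_of_nonneg_left ?_ hM.le
      refine (norm_queryPoint_sub_le G θ hm hM hf hη hηM hs i hj.le).trans ?_
      refine mul_le_mul_of_nonneg_right ?_ (by positivity)
      have : (2 : ℝ) ^ j ≤ 2 ^ J := pow_le_pow_right₀ (by norm_num) hj.le
      linarith
  refine h.trans (le_of_eq ?_)
  ring

/-- The drift is controlled by the direction itself and by the noise. -/
theorem norm_drift_le {m M s : ℝ} (hm : 0 < m) (hM : 0 < M) (hf : IsRegularLoss f m M)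
    (hη : 0 < η) (hηM : η * M ≤ 1) (hηK : s * M * 2 ^ J * η ≤ 1 / 2) (hs : ∑ i, |l i| ≤ s)
    (hs0 : 0 ≤ s) (hl : ∑ i, l i = 1) (hJ : 1 ≤ J) :
    ‖drift f G η J θ l‖ ≤ s * M * 2 ^ J * η
      * (2 * ‖roundDirection G η J θ l‖ + 4 * (s + 1) * totalNoise f G η J θ l) := by
  have h1 := norm_drift_le_of_weightedGrad G θ hm hM hf hη hηM hs hs0 hJ
  refine h1.trans (mul_le_mul_of_nonneg_left ?_ (by positivity))
  have hZ0 : 0 ≤ totalNoise f G η J θ l := totalNoise_nonneg f G θ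
  have h2 := norm_meanNoise_le f G (η := η) θ hs hJ
  have h3 := roundDirection_eq f G θ hη hJ hl
  -- Expressing the gradient through the direction brings the drift back on the right, where the
  -- factor `1 / 2` of `hηK` absorbs it.
  have h4 : weightedGrad f θ l
      = roundDirection G η J θ l - meanNoise f G η J θ l - drift f G η J θ l := by
    rw [h3]; abel
  have h5 : ‖weightedGrad f θ l‖ ≤ ‖roundDirection G η J θ l‖ + ‖meanNoise f G η J θ l‖
      + ‖drift f G η J θ l‖ := by
    nth_rewrite 1 [h4]
    exact (norm_sub_le _ _).trans (add_le_add_left (norm_sub_le _ _) _)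
  have h6 : 0 ≤ (2 + s) * totalNoise f G η J θ l + ‖weightedGrad f θ l‖ := by positivity
  have h7 := mul_le_mul_of_nonneg_right hηK h6
  nlinarith

end Direction

/-! ### One round -/

section Round

variable {d n : ℕ} {f : Fin n → Vec d → ℝ} {m M s : ℝ} {Θ : Set (Vec d)} {Λ : Set (Vec n)}

theorem neg_inner_le_half {E : Type*} [NormedAddCommGroup E] [InnerProductSpace ℝ E] {a : ℝ}
    (ha : 0 < a) (u v : E) : -inner ℝ u v ≤ a / 2 * ‖v‖ ^ 2 + 1 / (2 * a) * ‖u‖ ^ 2 := by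
  have h1 := neg_le_of_abs_le (abs_real_inner_le_norm u v)
  have h2 : 0 ≤ 1 / (2 * a) * (a * ‖v‖ - ‖u‖) ^ 2 := by positivity
  have h3 : 1 / (2 * a) * (a * ‖v‖ - ‖u‖) ^ 2
      = a / 2 * ‖v‖ ^ 2 + 1 / (2 * a) * ‖u‖ ^ 2 - ‖u‖ * ‖v‖ := by
    field_simp
    ring
  linarith

/-- Here `b` bounds the drift and `a` is the length of the primal step. Replacing `τ * v` by `a`
gives `b ≤ K * (2 * a + 4 * (s + 1) * τ * Z)`, so small `τ` lets `a ^ 2 / τ` absorb the first part.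
-/
theorem bias_sq_le {μ τ K s a b v Z : ℝ} (hμ : 0 < μ) (hτ : 0 < τ) (hb0 : 0 ≤ b)
    (hb : b ≤ K * τ * (2 * v + 4 * (s + 1) * Z)) (hv : τ * v = a) (hτ1 : τ ≤ 1)
    (hτμ : 4 * μ * τ ≤ 1) (hτK : 256 * K ^ 2 * τ ≤ μ) :
    1 / μ * b ^ 2 + 4 * τ * b ^ 2
      ≤ 1 / τ * (1 / 8) * (a ^ 2 / 2) + 64 * K ^ 2 * (s + 1) ^ 2 / μ * τ * Z ^ 2 := by
  have h1 : b ≤ K * (2 * a + τ * (4 * (s + 1) * Z)) := by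
    rw [← hv]; linarith
  have h2 : b ^ 2 ≤ K ^ 2 * (8 * a ^ 2 + τ ^ 2 * (32 * (s + 1) ^ 2 * Z ^ 2)) := by
    refine (pow_le_pow_left₀ hb0 h1 2).trans ?_
    rw [mul_pow]
    refine mul_le_mul_of_nonneg_left ?_ (by positivity)
    have h3 := sq_nonneg (2 * a - τ * (4 * (s + 1) * Z))
    have h4 : (2 * a - τ * (4 * (s + 1) * Z)) ^ 2
        = 8 * a ^ 2 + τ ^ 2 * (32 * (s + 1) ^ 2 * Z ^ 2)
          - (2 * a + τ * (4 * (s + 1) * Z)) ^ 2 := by ring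
    linarith
  have h3 : 4 * τ ≤ 1 / μ := by
    rw [le_div_iff₀ hμ]; linarith
  have h4 : 1 / μ * b ^ 2 + 4 * τ * b ^ 2 ≤ 2 * (1 / μ) * b ^ 2 := by
    nlinarith [mul_le_mul_of_nonneg_right h3 (sq_nonneg b)]
  have h5 := mul_le_mul_of_nonneg_left h2 (by positivity : 0 ≤ 2 * (1 / μ))
  have h6 : 2 * (1 / μ) * (K ^ 2 * (8 * a ^ 2))
      ≤ 1 / τ * (1 / 8) * (a ^ 2 / 2) := by
    have h7 : 256 * K ^ 2 / μ ≤ 1 / τ := by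
      rw [div_le_div_iff₀ hμ hτ]; linarith
    have h8 := mul_le_mul_of_nonneg_right h7 (by positivity : 0 ≤ a ^ 2 / 16)
    calc _ = 256 * K ^ 2 / μ * (a ^ 2 / 16) := by ring
      _ ≤ _ := h8
      _ = _ := by ring
  have h9 : 2 * (1 / μ) * (K ^ 2 * (τ ^ 2 * (32 * (s + 1) ^ 2 * Z ^ 2)))
      ≤ 64 * K ^ 2 * (s + 1) ^ 2 / μ * τ * Z ^ 2 := by
    have h10 : τ ^ 2 ≤ τ := by nlinarith
    have h11 := mul_le_mul_of_nonneg_right h10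
      (by positivity : 0 ≤ 64 * K ^ 2 * (s + 1) ^ 2 / μ * Z ^ 2)
    calc _ = τ ^ 2 * (64 * K ^ 2 * (s + 1) ^ 2 / μ * Z ^ 2) := by ring
      _ ≤ _ := h11
      _ = _ := by ring
  linarith

/-- The descent inequality of one round, for the primal points `xp, x, x'` of three successive
rounds, the dual points `l, l'` and a direction `v` with noise `N` and bias `B`. -/
theorem round_descent (hm : 0 < m) (hM : 0 < M) (hf : IsRegularLoss f m M) {μ : ℝ}
    (hμ_eq : μ = m - M * (s - 1) / 2) (hμ : 0 < μ) (hs : ∀ l ∈ Λ, ∑ i, |l i| ≤ s)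
    (hl : ∀ l ∈ Λ, ∑ i, l i = 1) {L : ℝ}
    (hLip : ∀ θ ∈ Θ, ∀ θ' ∈ Θ, ‖lossVec f θ - lossVec f θ'‖ ≤ L * ‖θ - θ'‖)
    {θs : Vec d} {ls : Vec n} (hsol : IsSolution f Θ Λ (θs, ls))
    {xp x x' : Vec d} {l l' : Vec n} (hxp : xp ∈ Θ) (hx : x ∈ Θ) (hx' : x' ∈ Θ) (hl' : l' ∈ Λ)
    {τ σ ς : ℝ} (hτ : 0 < τ) (hσ : 0 < σ) {v N B : Vec d}
    (hv : v = weightedGrad f x l' + N + B)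
    (hprimal : ∀ z ∈ Θ, inner ℝ (x - τ • v - x') (z - x') ≤ 0)
    (hdual : ∀ z ∈ Λ, inner ℝ (l - σ • (-((1 + ς) • lossVec f x - ς • lossVec f xp)) - l')
      (z - l') ≤ 0)
    {K Z : ℝ} (hB : ‖B‖ ≤ K * τ * (2 * ‖v‖ + 4 * (s + 1) * Z)) (hN : ‖N‖ ≤ s * Z)
    (hvx : τ * ‖v‖ = ‖x' - x‖) (hτ1 : τ ≤ 1) (hτμ : 4 * μ * τ ≤ 1) (hτs : 8 * (s * M) * τ ≤ 1)
    (hτK : 256 * K ^ 2 * τ ≤ μ) :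
    1 / τ * halfSqDist θs x' + 1 / σ * halfSqDist ls l'
        - inner ℝ (lossVec f x' - lossVec f x) (ls - l') + 1 / (2 * τ) * halfSqDist x' x
      ≤ (1 / τ - μ / 2) * halfSqDist θs x + 1 / σ * halfSqDist ls l
        - ς * inner ℝ (lossVec f x - lossVec f xp) (ls - l) + ς ^ 2 * σ * L ^ 2 * halfSqDist x xp
        - inner ℝ N (x - θs) + (64 * K ^ 2 * (s + 1) ^ 2 / μ + 4 * s ^ 2) * τ * Z ^ 2 := by
  have hθs := hsol.mem_primal
  have hls := hsol.mem_dual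
  have hp := inner_sub_le_of_variational hτ hprimal hθs
  have hd := inner_sub_le_of_variational hσ hdual hls
  have hsm := hf.objective_smooth hm hM (hs l' hl') x' x
  have hst := hf.objective_strong hm hM (hs l' hl') (hl l' hl') θs x
  rw [← hμ_eq] at hst
  have hgap : objective f θs l' ≤ objective f x' ls :=
    (hsol.dual_le l' hl').trans (hsol.le_primal x' hx')
  have hF : objective f x' ls = objective f x' l' + inner ℝ (lossVec f x') (ls - l') := by
    rw [objective_eq_inner, objective_eq_inner, inner_sub_right]; ring
  set q := lossVec f x - lossVec f xp with hq
  -- Extrapolation makes the coupling telescope: the terms with `ls - l'` and `ls - l` pass from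
  -- round to round, and only `l - l'` has to be absorbed by the dual step length.
  have hext : inner ℝ (lossVec f x') (ls - l')
      = inner ℝ (lossVec f x' - lossVec f x) (ls - l') - ς * inner ℝ q (ls - l)
        - ς * inner ℝ q (l - l')
        + inner ℝ (-((1 + ς) • lossVec f x - ς • lossVec f xp)) (l' - ls) := by
    have e1 : inner ℝ (-((1 + ς) • lossVec f x - ς • lossVec f xp)) (l' - ls)
        = inner ℝ (lossVec f x) (ls - l') + ς * inner ℝ q (ls - l') := by
      rw [show -((1 + ς) • lossVec f x - ς • lossVec f xp) = -(lossVec f x + ς • q) by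
        rw [hq]; module, show l' - ls = -(ls - l') by abel, inner_neg_neg, inner_add_left,
        real_inner_smul_left]
    have e2 : inner ℝ q (l - l') = inner ℝ q (ls - l') - inner ℝ q (ls - l) := by
      rw [← inner_sub_right]; congr 1; abel
    rw [e1, e2, inner_sub_left]
    ring
  have hq2 : ‖q‖ ^ 2 ≤ L ^ 2 * ‖x - xp‖ ^ 2 := by
    rw [← mul_pow]
    exact pow_le_pow_left₀ (norm_nonneg _) (hLip x hx xp hxp) 2
  have hdq : -(ς * inner ℝ q (l - l'))
      ≤ 1 / σ * (‖l' - l‖ ^ 2 / 2) + ς ^ 2 * σ * L ^ 2 * (‖x - xp‖ ^ 2 / 2) := by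
    have h1 := neg_inner_le_half (one_div_pos.mpr hσ) (ς • q) (l - l')
    rw [real_inner_smul_left, norm_smul, mul_pow, Real.norm_eq_abs, sq_abs, norm_sub_rev] at h1
    have h2 : 1 / (2 * (1 / σ)) = σ / 2 := by field_simp
    rw [h2] at h1
    have h3 : σ / 2 * (ς ^ 2 * ‖q‖ ^ 2) ≤ σ / 2 * (ς ^ 2 * (L ^ 2 * ‖x - xp‖ ^ 2)) := by gcongr
    linarith
  -- Splitting at `x` pairs `N` with `x - θs`, which is fixed before the samples of the round; the
  -- remaining pairing with `x' - x` is of second order.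
  have hinner : inner ℝ v (x' - θs) = inner ℝ (weightedGrad f x l') (x' - x)
      - inner ℝ (weightedGrad f x l') (θs - x) + inner ℝ N (x - θs) + inner ℝ B (x - θs)
      + inner ℝ (N + B) (x' - x) := by
    rw [hv, show x' - θs = (x' - x) + (x - θs) by abel, show θs - x = -(x - θs) by abel]
    simp only [inner_add_left, inner_add_right, inner_neg_right]
    ring
  -- Strong convexity supplies `μ * halfSqDist θs x`: half pays for the bias, half remains as
  -- contraction.
  have hB1 : -inner ℝ B (x - θs) ≤ μ / 2 * (‖θs - x‖ ^ 2 / 2) + 1 / μ * ‖B‖ ^ 2 := by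
    have h1 := neg_inner_le_half (half_pos hμ) B (x - θs)
    rw [norm_sub_rev] at h1
    have h2 : 1 / (2 * (μ / 2)) = 1 / μ := by field_simp
    rw [h2] at h1
    linarith
  -- Of the available `halfSqDist x' x / τ`, a quarter is spent here, an eighth on the squared bias
  -- and an eighth on smoothness; half is left.
  have hNB : -inner ℝ (N + B) (x' - x)
      ≤ 1 / τ * (1 / 4) * (‖x' - x‖ ^ 2 / 2) + 4 * τ * ‖N‖ ^ 2 + 4 * τ * ‖B‖ ^ 2 := by
    have h1 := neg_inner_le_half (by positivity : 0 < 1 / (4 * τ)) (N + B) (x' - x)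
    have h2 : 1 / (2 * (1 / (4 * τ))) = 2 * τ := by field_simp; norm_num
    have h3 : ‖N + B‖ ^ 2 ≤ 2 * ‖N‖ ^ 2 + 2 * ‖B‖ ^ 2 := by
      have h6 := pow_le_pow_left₀ (norm_nonneg _) (norm_add_le N B) 2
      have h7 := add_sq_le (a := ‖N‖) (b := ‖B‖)
      linarith
    have h4 := mul_le_mul_of_nonneg_left h3 (by positivity : 0 ≤ 2 * τ)
    have h5 : 1 / (4 * τ) / 2 * ‖x' - x‖ ^ 2 = 1 / τ * (1 / 4) * (‖x' - x‖ ^ 2 / 2) := by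
      field_simp
    rw [h2, h5] at h1
    linarith
  have hN2 : 4 * τ * ‖N‖ ^ 2 ≤ 4 * s ^ 2 * τ * Z ^ 2 := by
    have := pow_le_pow_left₀ (norm_nonneg _) hN 2
    have h4 := mul_le_mul_of_nonneg_left this (by positivity : 0 ≤ 4 * τ)
    linarith
  have hB2 := bias_sq_le hμ hτ (norm_nonneg B) hB hvx hτ1 hτμ hτK
  have hsmM : s * M / 2 * ‖x' - x‖ ^ 2 ≤ 1 / τ * (1 / 8) * (‖x' - x‖ ^ 2 / 2) := by
    have h7 : 8 * (s * M) ≤ 1 / τ := by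
      rw [le_div_iff₀ hτ]; linarith
    have h8 := mul_le_mul_of_nonneg_right h7 (by positivity : 0 ≤ ‖x' - x‖ ^ 2 / 16)
    linarith
  have e2τ : 1 / (2 * τ) = 1 / τ * (1 / 2) := by field_simp
  rw [e2τ]
  unfold halfSqDist
  linarith

end Round

/-! ### Measurability -/

section Measurability

variable {d n : ℕ}

theorem measurable_vec {α : Type*} [MeasurableSpace α] {k : ℕ} {u : α → Vec k}
    (h : ∀ i, Measurable fun a => u a i) : Measurable u := by
  have h1 : Measurable fun a => (u a).ofLp := measurable_pi_iff.mpr h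
  exact (WithLp.measurable_toLp 2 (Fin k → ℝ)).comp h1

/-- Each coordinate is a pointwise limit of difference quotients, which are jointly measurable. -/
theorem measurable_sampleGrad {X : Type*} [MeasurableSpace X] {g : Vec d → X → ℝ}
    (hg : Measurable fun q : Vec d × X => g q.1 q.2)
    (hd : ∀ x, Differentiable ℝ fun θ => g θ x) :
    Measurable fun q : Vec d × X => sampleGrad g q.1 q.2 := by
  refine measurable_vec fun k => ?_
  have hlim : ∀ q : Vec d × X, Filter.Tendsto
      (fun N : ℕ => ((N : ℝ) + 1) * (g (q.1 + ((N : ℝ) + 1)⁻¹ • EuclideanSpace.single k 1) q.2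
        - g q.1 q.2)) Filter.atTop (nhds (sampleGrad g q.1 q.2 k)) := by
    intro q
    have h1 := (hd q.2 q.1).hasGradientAt.hasFDerivAt
    have h2 := h1.lim (EuclideanSpace.single k (1 : ℝ)) (c := fun N : ℕ => (N : ℝ) + 1)
      (l := Filter.atTop) (by
        refine Filter.Tendsto.congr (f₁ := fun N : ℕ => (N : ℝ) + 1) (fun N => ?_)
          (Filter.tendsto_atTop_add_const_right _ _ tendsto_natCast_atTop_atTop)
        rw [Real.norm_of_nonneg (by positivity)])
    have h3 : (InnerProductSpace.toDual ℝ (Vec d)) (gradient (fun θ => g θ q.2) q.1)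
        (EuclideanSpace.single k (1 : ℝ)) = sampleGrad g q.1 q.2 k := by
      rw [InnerProductSpace.toDual_apply_apply, EuclideanSpace.inner_single_right]
      simp [sampleGrad]
    rw [h3] at h2
    exact h2
  refine measurable_of_tendsto_metrizable (fun N => ?_) (tendsto_pi_nhds.mpr hlim)
  refine Measurable.const_mul (Measurable.sub ?_ hg) _
  exact hg.comp ((measurable_fst.add_const _).prodMk measurable_snd)

/-- Only fields with index below `j` enter, which is what keeps the `j`-th sample independent of its
query point. -/
theorem measurable_queryPoint {Ω : Type*} {mΩ : MeasurableSpace Ω}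
    {G : Ω → Fin n → ℕ → Vec d → Vec d} (η : ℝ) {θ : Ω → Vec d} {l : Ω → Vec n}
    (hθ : Measurable θ) (hl : Measurable l) (i : Fin n) (j : ℕ)
    (hG : ∀ i', ∀ j' < j, ∀ u : Ω → Vec d, Measurable u → Measurable fun ω => G ω i' j' (u ω)) :
    Measurable fun ω => queryPoint (G ω) η (θ ω) (l ω) i j := by
  match j with
  | 0 => exact hθ
  | j + 1 =>
    induction j with
    | zero => exact hθ
    | succ j ih =>
      have h := ih fun i' j' hj' => hG i' j' (by omega)
      have hl' : ∀ k, Measurable fun ω => l ω k := fun k => by fun_prop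
      have h1 : Measurable fun ω => ∑ k, l ω k • G ω k 0 (θ ω) :=
        Finset.measurable_fun_sum _ fun k _ => (hl' k).smul (hG k 0 (by omega) θ hθ)
      exact h.sub ((((hG i (j + 1) (by omega) _ h).sub (hG i 0 (by omega) θ hθ)).add
        h1).const_smul η)

theorem measurable_roundDirection {Ω : Type*} {mΩ : MeasurableSpace Ω}
    {G : Ω → Fin n → ℕ → Vec d → Vec d} (η : ℝ) (J : ℕ) {θ : Ω → Vec d} {l : Ω → Vec n}
    (hθ : Measurable θ) (hl : Measurable l)
    (hG : ∀ i', ∀ j' ≤ J, ∀ u : Ω → Vec d, Measurable u → Measurable fun ω => G ω i' j' (u ω)) :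
    Measurable fun ω => roundDirection (G ω) η J (θ ω) (l ω) := by
  have hl' : ∀ k, Measurable fun ω => l ω k := fun k => by fun_prop
  refine Finset.measurable_fun_sum _ fun i _ => (hl' i).smul ?_
  have h : Measurable fun ω => queryPoint (G ω) η (θ ω) (l ω) i (J + 1) :=
    measurable_queryPoint η hθ hl i (J + 1) fun i' j' hj' => hG i' j' (by omega)
  exact (hθ.sub h).const_smul (1 / (η * (J : ℝ)))

end Measurability

/-! ### Noise of one stochastic gradient -/

section Noise

variable {d n : ℕ} {X Ω : Type*} [MeasurableSpace X] [MeasurableSpace Ω] {μ : Measure Ω}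
  [IsProbabilityMeasure μ] {f : Fin n → Vec d → ℝ} {g : Fin n → Vec d → X → ℝ}
  {P : Fin n → Measure X} {δ : ℝ}

theorem IsStochasticModel.measurable_sampleGrad (h : IsStochasticModel f g P δ) (i : Fin n) :
    Measurable fun q : Vec d × X => sampleGrad (g i) q.1 q.2 :=
  ScaffPDIA.measurable_sampleGrad (h.measurable i) (h.differentiable i)

theorem IsStochasticModel.measurable_noise (h : IsStochasticModel f g P δ)
    (hf : ∀ i, Continuous (gradient (f i))) (i : Fin n) :
    Measurable fun q : Vec d × X => sampleGrad (g i) q.1 q.2 - gradient (f i) q.1 :=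
  (h.measurable_sampleGrad i).sub ((hf i).measurable.comp measurable_fst)

/-- The second moment of the noise at a random point independent of the sample. -/
theorem IsStochasticModel.lintegral_noise_le (h : IsStochasticModel f g P δ)
    (hf : ∀ i, Continuous (gradient (f i))) (i : Fin n) {u : Ω → Vec d} {ξ : Ω → X}
    (hu : Measurable u) (hξ : Measurable ξ) (hlaw : μ.map ξ = P i) (hind : IndepFun u ξ μ) :
    ∫⁻ ω, ‖sampleGrad (g i) (u ω) (ξ ω) - gradient (f i) (u ω)‖ₑ ^ 2 ∂μ
      ≤ ENNReal.ofReal (δ ^ 2) := by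
  have := h.isProb i
  have hm := ((h.measurable_noise hf i).enorm).pow_const 2
  have h1 := (indepFun_iff_map_prod_eq_prod_map_map hu.aemeasurable hξ.aemeasurable).mp hind
  rw [hlaw] at h1
  have h2 : ∫⁻ ω, ‖sampleGrad (g i) (u ω) (ξ ω) - gradient (f i) (u ω)‖ₑ ^ 2 ∂μ
      = ∫⁻ q, ‖sampleGrad (g i) q.1 q.2 - gradient (f i) q.1‖ₑ ^ 2
        ∂(μ.map fun ω => (u ω, ξ ω)) := (lintegral_map hm (hu.prodMk hξ)).symm
  rw [h2, h1, lintegral_prod _ hm.aemeasurable]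
  have : IsProbabilityMeasure (μ.map u) := Measure.isProbabilityMeasure_map hu.aemeasurable
  calc _ ≤ ∫⁻ _, ENNReal.ofReal (δ ^ 2) ∂(μ.map u) := by
        refine lintegral_mono fun x => ?_
        have := h.variance_le i x
        rwa [← h.mean_grad i x] at this
    _ = _ := by simp

theorem IsStochasticModel.integrable_noise_sq (h : IsStochasticModel f g P δ)
    (hf : ∀ i, Continuous (gradient (f i))) (i : Fin n) {u : Ω → Vec d} {ξ : Ω → X}
    (hu : Measurable u) (hξ : Measurable ξ) (hlaw : μ.map ξ = P i) (hind : IndepFun u ξ μ) :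
    Integrable (fun ω => ‖sampleGrad (g i) (u ω) (ξ ω) - gradient (f i) (u ω)‖ ^ 2) μ ∧
    ∫ ω, ‖sampleGrad (g i) (u ω) (ξ ω) - gradient (f i) (u ω)‖ ^ 2 ∂μ ≤ δ ^ 2 := by
  have h1 := h.lintegral_noise_le hf i hu hξ hlaw hind
  have hm : Measurable fun ω => ‖sampleGrad (g i) (u ω) (ξ ω) - gradient (f i) (u ω)‖ ^ 2 :=
    (((h.measurable_noise hf i).comp (hu.prodMk hξ)).norm).pow_const 2
  have h2 : ∀ ω, ENNReal.ofReal (‖sampleGrad (g i) (u ω) (ξ ω) - gradient (f i) (u ω)‖ ^ 2)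
      = ‖sampleGrad (g i) (u ω) (ξ ω) - gradient (f i) (u ω)‖ₑ ^ 2 := fun ω => by
    rw [ENNReal.ofReal_pow (norm_nonneg _), ofReal_norm]
  have h3 : ∫⁻ ω, ENNReal.ofReal
      (‖sampleGrad (g i) (u ω) (ξ ω) - gradient (f i) (u ω)‖ ^ 2) ∂μ
      ≤ ENNReal.ofReal (δ ^ 2) := by simpa only [h2] using h1
  refine ⟨⟨hm.aestronglyMeasurable, ?_⟩, ?_⟩
  · rw [hasFiniteIntegral_iff_ofReal (Filter.Eventually.of_forall fun ω => by positivity)]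
    exact h3.trans_lt ENNReal.ofReal_lt_top
  · rw [integral_eq_lintegral_of_nonneg_ae (Filter.Eventually.of_forall fun ω => by positivity)
      hm.aestronglyMeasurable]
    exact ENNReal.toReal_le_of_le_ofReal (sq_nonneg δ) h3

theorem integrable_inner_of_norm_le {E : Type*} [NormedAddCommGroup E] [InnerProductSpace ℝ E]
    {w v : Ω → E} {C : ℝ} (hC : ∀ ω, ‖w ω‖ ≤ C) (hw : AEStronglyMeasurable w μ)
    (hv : AEStronglyMeasurable v μ) (hsq : Integrable (fun ω => ‖v ω‖ ^ 2) μ) :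
    Integrable (fun ω => inner ℝ (w ω) (v ω)) μ := by
  refine Integrable.mono' ((hsq.const_mul C).add (integrable_const C)) (hw.inner hv)
    (Filter.Eventually.of_forall fun ω => ?_)
  have hC0 : 0 ≤ C := (norm_nonneg _).trans (hC ω)
  have h1 : ‖v ω‖ ≤ ‖v ω‖ ^ 2 + 1 := by nlinarith [sq_nonneg (‖v ω‖ - 1)]
  calc _ ≤ ‖w ω‖ * ‖v ω‖ := norm_inner_le_norm _ _
    _ ≤ C * (‖v ω‖ ^ 2 + 1) := mul_le_mul (hC ω) h1 (norm_nonneg _) hC0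
    _ = C * ‖v ω‖ ^ 2 + C := by ring

/-- A function `h` of a random point and an independent sample that is centered in the sample is
orthogonal to any bounded test vector that is independent of the sample. -/
theorem integral_inner_eq_zero {ν : Measure X} [IsProbabilityMeasure ν] {h : Vec d × X → Vec d}
    (hm : Measurable h) (hi : ∀ y, Integrable (fun x => h (y, x)) ν)
    (h0 : ∀ y, ∫ x, h (y, x) ∂ν = 0) {u w : Ω → Vec d} {ξ : Ω → X} {C : ℝ}
    (hu : Measurable u) (hw : Measurable w) (hC : ∀ ω, ‖w ω‖ ≤ C) (hξ : Measurable ξ)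
    (hlaw : μ.map ξ = ν) (hind : IndepFun (fun ω => (u ω, w ω)) ξ μ)
    (hsq : Integrable (fun ω => ‖h (u ω, ξ ω)‖ ^ 2) μ) :
    Integrable (fun ω => inner ℝ (w ω) (h (u ω, ξ ω))) μ ∧
    ∫ ω, inner ℝ (w ω) (h (u ω, ξ ω)) ∂μ = 0 := by
  have hm0 : Measurable fun q : (Vec d × Vec d) × X => h (q.1.1, q.2) :=
    hm.comp ((measurable_fst.comp measurable_fst).prodMk measurable_snd)
  have hm1 : Measurable fun q : (Vec d × Vec d) × X => inner ℝ q.1.2 (h (q.1.1, q.2)) :=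
    (measurable_snd.comp measurable_fst).inner hm0
  have hpair := (hu.prodMk hw).prodMk hξ
  have hint := integrable_inner_of_norm_le hC hw.aestronglyMeasurable
    (hm.comp (hu.prodMk hξ)).aestronglyMeasurable hsq
  refine ⟨hint, ?_⟩
  have h1 := (indepFun_iff_map_prod_eq_prod_map_map (hu.prodMk hw).aemeasurable
    hξ.aemeasurable).mp hind
  rw [hlaw] at h1
  have h2 := integral_map (μ := μ) hpair.aemeasurable hm1.aestronglyMeasurable
  have hint2 := (integrable_map_measure (μ := μ) hm1.aestronglyMeasurable
    hpair.aemeasurable).mpr hint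
  have : IsProbabilityMeasure (μ.map fun ω => (u ω, w ω)) :=
    Measure.isProbabilityMeasure_map (hu.prodMk hw).aemeasurable
  rw [h1] at hint2 h2
  rw [← h2, integral_prod _ hint2]
  have h3 : ∀ y : Vec d × Vec d, ∫ x, inner ℝ y.2 (h (y.1, x)) ∂ν = 0 := fun y => by
    rw [integral_inner (hi y.1), h0, inner_zero_right]
  simp [h3]

/-- The noise at a random point has mean zero against any bounded test vector that is independent
of the sample. -/
theorem IsStochasticModel.integral_inner_noise (h : IsStochasticModel f g P δ)
    (hf : ∀ i, Continuous (gradient (f i))) (i : Fin n) {u w : Ω → Vec d} {ξ : Ω → X} {C : ℝ}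
    (hu : Measurable u) (hw : Measurable w) (hC : ∀ ω, ‖w ω‖ ≤ C) (hξ : Measurable ξ)
    (hlaw : μ.map ξ = P i) (hind : IndepFun (fun ω => (u ω, w ω)) ξ μ) :
    Integrable (fun ω => inner ℝ (w ω)
      (sampleGrad (g i) (u ω) (ξ ω) - gradient (f i) (u ω))) μ ∧
    ∫ ω, inner ℝ (w ω) (sampleGrad (g i) (u ω) (ξ ω) - gradient (f i) (u ω)) ∂μ = 0 := by
  have := h.isProb i
  have hind' : IndepFun u ξ μ := hind.comp (φ := Prod.fst) (ψ := id) measurable_fst measurable_id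
  refine integral_inner_eq_zero (h.measurable_noise hf i)
    (fun y => (h.integrable_grad i y).sub (integrable_const (gradient (f i) y))) (fun y => ?_) hu hw hC hξ hlaw hind
    (h.integrable_noise_sq hf i hu hξ hlaw hind').1
  refine (integral_sub (h.integrable_grad i y) (integrable_const (gradient (f i) y))).trans ?_
  rw [← h.mean_grad i y]
  simp

end Noise

/-! ### The history of the samples -/

section History

variable {n : ℕ} {X Ω : Type*} [MeasurableSpace X] {mΩ : MeasurableSpace Ω}

/-- The indices `(i, j, r)` of the samples which the algorithm uses. -/
abbrev SampleIndex (n J : ℕ) : Type := {q : Fin n × ℕ × ℕ // q.2.1 ≤ J ∧ 1 ≤ q.2.2}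

/-- The `σ`-algebra of the samples with indices in `S`. -/
abbrev samplesIn (J : ℕ) (ξ : Fin n → ℕ → ℕ → Ω → X) (S : Set (SampleIndex n J)) :
    MeasurableSpace Ω :=
  ⨆ q ∈ S, MeasurableSpace.comap (ξ q.1.1 q.1.2.1 q.1.2.2) inferInstance

/-- The `σ`-algebra of the samples of the rounds before round `r`. -/
abbrev past (J : ℕ) (ξ : Fin n → ℕ → ℕ → Ω → X) (r : ℕ) : MeasurableSpace Ω :=
  samplesIn J ξ {q | q.1.2.2 < r}

theorem samplesIn_mono {J : ℕ} (ξ : Fin n → ℕ → ℕ → Ω → X) {S T : Set (SampleIndex n J)}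
    (h : S ⊆ T) : samplesIn J ξ S ≤ samplesIn J ξ T :=
  biSup_mono h

theorem measurable_sample {J : ℕ} (ξ : Fin n → ℕ → ℕ → Ω → X) {S : Set (SampleIndex n J)}
    {i : Fin n} {j r : ℕ} (hj : j ≤ J) (hr : 1 ≤ r) (h : ⟨(i, j, r), hj, hr⟩ ∈ S) :
    Measurable[samplesIn J ξ S] (ξ i j r) :=
  measurable_iff_comap_le.mpr (le_iSup₂_of_le (f := fun (q : SampleIndex n J) (_ : q ∈ S) =>
    MeasurableSpace.comap (ξ q.1.1 q.1.2.1 q.1.2.2) inferInstance) _ h le_rfl)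

theorem past_le_compl {J r : ℕ} (ξ : Fin n → ℕ → ℕ → Ω → X) {i : Fin n} {j : ℕ} (hj : j ≤ J)
    (hr : 1 ≤ r) : past J ξ r ≤ samplesIn J ξ {⟨(i, j, r), hj, hr⟩}ᶜ :=
  samplesIn_mono ξ fun q hq => by
    rintro rfl
    have h : r < r := hq
    exact lt_irrefl _ h

theorem IsSampling.samplesIn_le {P : Fin n → Measure X} {J : ℕ} {μ : Measure Ω}
    {ξ : Fin n → ℕ → ℕ → Ω → X} (h : IsSampling P J μ ξ) (S : Set (SampleIndex n J)) :
    samplesIn J ξ S ≤ mΩ :=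
  iSup₂_le fun q _ => (h.measurable _ _ _ q.2.1 q.2.2).comap_le

/-- A quantity that does not involve a sample is independent of it. -/
theorem IsSampling.indepFun {P : Fin n → Measure X} {J : ℕ} {μ : Measure Ω}
    {ξ : Fin n → ℕ → ℕ → Ω → X} (h : IsSampling P J μ ξ) {Y : Type*} [MeasurableSpace Y]
    {i : Fin n} {j r : ℕ} (hj : j ≤ J) (hr : 1 ≤ r) {u : Ω → Y}
    (hu : Measurable[samplesIn J ξ {⟨(i, j, r), hj, hr⟩}ᶜ] u) : IndepFun u (ξ i j r) μ := by
  have h1 := indep_iSup_of_disjoint (fun q : SampleIndex n J =>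
    (h.measurable q.1.1 q.1.2.1 q.1.2.2 q.2.1 q.2.2).comap_le) h.indep.iIndep
    (disjoint_compl_left (a := ({⟨(i, j, r), hj, hr⟩} : Set (SampleIndex n J))))
  rw [iSup_singleton] at h1
  exact IndepFun_iff_Indep .. |>.mpr (indep_of_indep_of_le_left h1 (measurable_iff_comap_le.mp hu))

end History

/-! ### Runs of the algorithm -/

section Run

variable {d n : ℕ} {X Ω : Type*} {f : Fin n → Vec d → ℝ}
  {g : Fin n → Vec d → X → ℝ} {Θ : Set (Vec d)} {A B : Set (Vec n)} {φ : ℝ} {J : ℕ} {H : Hyper}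
  {ξ : Fin n → ℕ → ℕ → Ω → X} {R : ℕ} {θ₀ : Vec d} {l₀ : Vec n} {θ : ℕ → Ω → Vec d}
  {l : ℕ → Ω → Vec n}

theorem IsRun.mem_primal (hrun : IsRun f g Θ A B φ J H ξ R θ₀ l₀ θ l) (hθ₀ : θ₀ ∈ Θ) {r : ℕ}
    (hr : r ≤ R + 1) (ω : Ω) : θ r ω ∈ Θ := by
  match r with
  | 0 => rw [hrun.primal_zero]; exact hθ₀
  | 1 => rw [hrun.primal_one]; exact hθ₀
  | r + 2 => exact (hrun.primal_step (r + 1) (by omega) (by omega) ω).1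

theorem IsRun.mem_dual (hrun : IsRun f g Θ A B φ J H ξ R θ₀ l₀ θ l)
    (hl₀ : l₀ ∈ integratedSet φ A B) {r : ℕ} (hr : r ≤ R + 1) (ω : Ω) :
    l r ω ∈ integratedSet φ A B := by
  match r with
  | 0 => rw [hrun.dual_zero]; exact hl₀
  | 1 => rw [hrun.dual_one]; exact hl₀
  | r + 2 =>
    obtain ⟨a, ha, b, hb, -, h⟩ := hrun.dual_step (r + 1) (by omega) (by omega) ω
    exact ⟨a, ha, b, hb, h⟩

theorem IsRun.primal_variational (hrun : IsRun f g Θ A B φ J H ξ R θ₀ l₀ θ l) (hH : H.Pos)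
    (hΘ : Convex ℝ Θ) {r : ℕ} (h1 : 1 ≤ r) (hr : r ≤ R) (ω : Ω) :
    ∀ z ∈ Θ, inner ℝ (θ r ω - H.τ r • direction g J H ξ θ l r ω - θ (r + 1) ω)
      (z - θ (r + 1) ω) ≤ 0 := fun _ hz =>
  have h := hrun.primal_step r h1 hr ω
  IsMinOn.inner_prox_le hΘ (hH.τ_pos r) h.1 h.2 hz

/-- The pair `(a, b)` enters the dual objective only through `combine`, so the step is a proximal
step on `Λ`, where convexity is available; `A` and `B` need not be convex. -/
theorem IsRun.dual_variational (hrun : IsRun f g Θ A B φ J H ξ R θ₀ l₀ θ l) (hH : H.Pos)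
    (hΛ : Convex ℝ (integratedSet φ A B)) {r : ℕ} (h1 : 1 ≤ r) (hr : r ≤ R) (ω : Ω) :
    ∀ z ∈ integratedSet φ A B, inner ℝ (l r ω - H.σ r • (-extrapolated f H θ r ω) - l (r + 1) ω)
      (z - l (r + 1) ω) ≤ 0 := by
  intro z hz
  obtain ⟨a, ha, b, hb, hmin, h⟩ := hrun.dual_step r h1 hr ω
  rw [h]
  refine IsMinOn.inner_prox_le hΛ (hH.σ_pos r) ⟨a, ha, b, hb, rfl⟩ ?_ hz
  refine isMinOn_iff.mpr ?_
  rintro _ ⟨a', ha', b', hb', rfl⟩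
  have := isMinOn_iff.mp hmin (a', b') ⟨ha', hb'⟩
  rwa [inner_neg_left, inner_neg_left]

theorem continuous_lossVec (hf : ∀ i, Continuous (f i)) : Continuous (lossVec f) :=
  (PiLp.continuous_toLp 2 _).comp (continuous_pi hf)

theorem IsRun.measurable_dual_step {mΩ : MeasurableSpace Ω}
    (hrun : IsRun f g Θ A B φ J H ξ R θ₀ l₀ θ l) (hH : H.Pos) (hf : ∀ i, Continuous (f i))
    (hΛ : Convex ℝ (integratedSet φ A B)) (hΛc : IsCompact (integratedSet φ A B))
    (hΛ_ne : (integratedSet φ A B).Nonempty) {r : ℕ} (h1 : 1 ≤ r) (hr : r ≤ R)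
    (hθ : Measurable (θ r)) (hθ' : Measurable (θ (r - 1))) (hl : Measurable (l r)) :
    Measurable (l (r + 1)) := by
  have heq : l (r + 1) = fun ω => nearest (integratedSet φ A B)
      (l r ω - H.σ r • (-extrapolated f H θ r ω)) := by
    funext ω
    obtain ⟨a, ha, b, hb, -, h⟩ := hrun.dual_step r h1 hr ω
    exact eq_nearest hΛ_ne hΛc.isComplete hΛ ⟨a, ha, b, hb, h⟩
      (hrun.dual_variational hH hΛ h1 hr ω)
  rw [heq]
  have hL := (continuous_lossVec hf).measurable
  exact (continuous_nearest hΛ_ne hΛc.isComplete hΛ).measurable.comp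
    (hl.sub ((((hL.comp hθ).const_smul (1 + H.ς r)).sub
      ((hL.comp hθ').const_smul (H.ς r))).neg.const_smul (H.σ r)))

theorem IsRun.measurable_primal_step [MeasurableSpace X] {mΩ : MeasurableSpace Ω}
    (hrun : IsRun f g Θ A B φ J H ξ R θ₀ l₀ θ l) (hH : H.Pos)
    (hg : ∀ i, Measurable fun q : Vec d × X => sampleGrad (g i) q.1 q.2)
    (hΘ : Convex ℝ Θ) (hΘc : IsCompact Θ) (hΘ_ne : Θ.Nonempty) {r : ℕ} (h1 : 1 ≤ r) (hr : r ≤ R)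
    (hθ : Measurable (θ r)) (hl : Measurable (l (r + 1)))
    (hξ : ∀ i, ∀ j ≤ J, Measurable (ξ i j r)) : Measurable (θ (r + 1)) := by
  have heq : θ (r + 1) = fun ω => nearest Θ
      (θ r ω - H.τ r • direction g J H ξ θ l r ω) := by
    funext ω
    exact eq_nearest hΘ_ne hΘc.isComplete hΘ (hrun.primal_step r h1 hr ω).1
      (hrun.primal_variational hH hΘ h1 hr ω)
  rw [heq]
  have hd : Measurable fun ω => direction g J H ξ θ l r ω :=
    measurable_roundDirection (H.η r) J hθ hl fun i j hj u hu => (hg i).comp (hu.prodMk (hξ i j hj))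
  exact (continuous_nearest hΘ_ne hΘc.isComplete hΘ).measurable.comp (hθ.sub (hd.const_smul (H.τ r)))

/-- The iterates entering round `k + 1` depend on the samples of the earlier rounds only. -/
theorem IsRun.measurable_past [MeasurableSpace X] (hrun : IsRun f g Θ A B φ J H ξ R θ₀ l₀ θ l) (hH : H.Pos)
    (hf : ∀ i, Continuous (f i))
    (hg : ∀ i, Measurable fun q : Vec d × X => sampleGrad (g i) q.1 q.2)
    (hΘ : Convex ℝ Θ) (hΘc : IsCompact Θ) (hΘ_ne : Θ.Nonempty)
    (hΛ : Convex ℝ (integratedSet φ A B)) (hΛc : IsCompact (integratedSet φ A B))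
    (hΛ_ne : (integratedSet φ A B).Nonempty) {k : ℕ} (hk : k ≤ R) :
    Measurable[past J ξ (k + 1)] (θ (k + 1)) ∧ Measurable[past J ξ (k + 1)] (θ k) ∧
      Measurable[past J ξ (k + 1)] (l (k + 1)) := by
  induction k with
  | zero =>
    have e0 : θ 0 = fun _ => θ₀ := funext hrun.primal_zero
    have e1 : θ (0 + 1) = fun _ => θ₀ := funext hrun.primal_one
    have e2 : l (0 + 1) = fun _ => l₀ := funext hrun.dual_one
    rw [e0, e1, e2]
    exact ⟨measurable_const, measurable_const, measurable_const⟩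
  | succ k ih =>
    obtain ⟨h1, h2, h3⟩ := ih (by omega)
    have hmono : past J ξ (k + 1) ≤ past J ξ (k + 1 + 1) :=
      samplesIn_mono ξ fun q hq => by
        have h : q.1.2.2 < k + 1 := hq
        exact (by omega : q.1.2.2 < k + 1 + 1)
    have h4 := hrun.measurable_dual_step hH hf hΛ hΛc hΛ_ne (by omega : 1 ≤ k + 1) hk h1 h2 h3
    have h5 := h1.mono hmono le_rfl
    have h6 := h4.mono hmono le_rfl
    exact ⟨hrun.measurable_primal_step hH hg hΘ hΘc hΘ_ne (by omega) hk h5 h6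
      fun i j hj => measurable_sample ξ hj (by omega) (show k + 1 < k + 1 + 1 by omega), h5, h6⟩

end Run

/-! ### Expectations in one round -/

section GradField

/-- The stochastic gradient fields of round `r` at the outcome `ω`. -/
noncomputable def gradField {d n : ℕ} {X Ω : Type*} (g : Fin n → Vec d → X → ℝ) (ξ : Fin n → ℕ → ℕ → Ω → X) (r : ℕ)
    (ω : Ω) (i : Fin n) (j : ℕ) (x : Vec d) : Vec d :=
  sampleGrad (g i) x (ξ i j r ω)

variable {d n : ℕ} {X Ω : Type*} [MeasurableSpace X] {g : Fin n → Vec d → X → ℝ}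

theorem measurable_queryPoint_compl {J r : ℕ} {ξ : Fin n → ℕ → ℕ → Ω → X} {θ : Ω → Vec d}
    {l : Ω → Vec n}
    (hg : ∀ i, Measurable fun q : Vec d × X => sampleGrad (g i) q.1 q.2) (η : ℝ) (hr : 1 ≤ r)
    (hθ : Measurable[past J ξ r] θ) (hl : Measurable[past J ξ r] l) (i : Fin n) {j : ℕ}
    (hj : j ≤ J) : Measurable[samplesIn J ξ {⟨(i, j, r), hj, hr⟩}ᶜ]
      fun ω => queryPoint (gradField g ξ r ω) η (θ ω) (l ω) i j := by
  have hle := past_le_compl ξ (i := i) hj hr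
  refine measurable_queryPoint η (hθ.mono hle le_rfl) (hl.mono hle le_rfl) i j
    fun i' j' hj' u hu => (hg i').comp (hu.prodMk ?_)
  refine measurable_sample ξ (hj'.le.trans hj) hr ?_
  intro h
  have : j' = j := congrArg (fun q : SampleIndex n J => q.1.2.1) h
  omega

end GradField

section Expectation

variable {d n : ℕ} {X Ω : Type*} [MeasurableSpace X] [MeasurableSpace Ω] {μ : Measure Ω}
  [IsProbabilityMeasure μ] {f : Fin n → Vec d → ℝ} {g : Fin n → Vec d → X → ℝ}
  {P : Fin n → Measure X} {δ : ℝ} {J r : ℕ} {ξ : Fin n → ℕ → ℕ → Ω → X} {θ : Ω → Vec d}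
  {l : Ω → Vec n}

theorem IsStochasticModel.integrable_roundNoise_sq (h : IsStochasticModel f g P δ)
    (hS : IsSampling P J μ ξ) (hf : ∀ i, Continuous (gradient (f i))) (η : ℝ) (hr : 1 ≤ r)
    (hθ : Measurable[past J ξ r] θ) (hl : Measurable[past J ξ r] l) (i : Fin n) {j : ℕ}
    (hj : j ≤ J) :
    Integrable (fun ω => ‖roundNoise f (gradField g ξ r ω) η (θ ω) (l ω) i j‖ ^ 2) μ ∧
    ∫ ω, ‖roundNoise f (gradField g ξ r ω) η (θ ω) (l ω) i j‖ ^ 2 ∂μ ≤ δ ^ 2 := by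
  have hq := measurable_queryPoint_compl h.measurable_sampleGrad η hr hθ hl i hj
  exact h.integrable_noise_sq hf i (hq.mono (hS.samplesIn_le _) le_rfl)
    (hS.measurable i j r hj hr) (hS.law i j r hj hr) (hS.indepFun hj hr hq)

theorem IsStochasticModel.integral_inner_roundNoise (h : IsStochasticModel f g P δ)
    (hS : IsSampling P J μ ξ) (hf : ∀ i, Continuous (gradient (f i))) (η : ℝ) (hr : 1 ≤ r)
    (hθ : Measurable[past J ξ r] θ) (hl : Measurable[past J ξ r] l) {w : Ω → Vec d}
    (hw : Measurable[past J ξ r] w) {C : ℝ} (hC : ∀ ω, ‖w ω‖ ≤ C) (i : Fin n) {j : ℕ}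
    (hj : j ≤ J) :
    Integrable (fun ω => inner ℝ (w ω)
      (roundNoise f (gradField g ξ r ω) η (θ ω) (l ω) i j)) μ ∧
    ∫ ω, inner ℝ (w ω) (roundNoise f (gradField g ξ r ω) η (θ ω) (l ω) i j) ∂μ = 0 := by
  have hq := measurable_queryPoint_compl h.measurable_sampleGrad η hr hθ hl i hj
  have hw' := hw.mono (past_le_compl ξ (i := i) hj hr) le_rfl
  exact h.integral_inner_noise hf i (hq.mono (hS.samplesIn_le _) le_rfl)
    (hw'.mono (hS.samplesIn_le _) le_rfl) hC
    (hS.measurable i j r hj hr) (hS.law i j r hj hr) (hS.indepFun hj hr (hq.prodMk hw'))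

theorem totalNoise_sq_le (f : Fin n → Vec d → ℝ) (G : Fin n → ℕ → Vec d → Vec d) (η : ℝ) (J : ℕ)
    (θ : Vec d) (l : Vec n) : totalNoise f G η J θ l ^ 2
      ≤ (n * (J + 1)) * ∑ i, ∑ j ∈ Finset.range (J + 1), ‖roundNoise f G η θ l i j‖ ^ 2 := by
  unfold totalNoise
  rw [← Finset.sum_product', ← Finset.sum_product']
  refine sq_sum_le_card_mul_sum_sq.trans (le_of_eq ?_)
  simp

/-- The dominating `S` comes from Cauchy–Schwarz over the `n * (J + 1)` errors; summing their
variances gives the second such factor. -/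
theorem IsStochasticModel.integrable_totalNoise_sq (h : IsStochasticModel f g P δ)
    (hS : IsSampling P J μ ξ) (hf : ∀ i, Continuous (gradient (f i))) (η : ℝ) (hr : 1 ≤ r)
    (hθ : Measurable[past J ξ r] θ) (hl : Measurable[past J ξ r] l) :
    ∃ S : Ω → ℝ, (∀ ω, totalNoise f (gradField g ξ r ω) η J (θ ω) (l ω) ^ 2 ≤ S ω) ∧
      Integrable S μ ∧ ∫ ω, S ω ∂μ ≤ (n * (J + 1)) ^ 2 * δ ^ 2 := by
  have hi : ∀ i : Fin n, ∀ j ∈ Finset.range (J + 1), Integrable (fun ω =>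
      ‖roundNoise f (gradField g ξ r ω) η (θ ω) (l ω) i j‖ ^ 2) μ := fun i j hj =>
    (h.integrable_roundNoise_sq hS hf η hr hθ hl i (by have := Finset.mem_range.mp hj; omega)).1
  refine ⟨fun ω => (n * (J + 1)) * ∑ i, ∑ j ∈ Finset.range (J + 1),
    ‖roundNoise f (gradField g ξ r ω) η (θ ω) (l ω) i j‖ ^ 2,
    fun ω => totalNoise_sq_le _ _ _ _ _ _, ?_, ?_⟩
  · exact (integrable_finsetSum _ fun i _ => integrable_finsetSum _ (hi i)).const_mul _
  · rw [integral_const_mul, integral_finsetSum _ fun i _ => integrable_finsetSum _ (hi i)]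
    have h1 : ∀ i : Fin n, ∫ ω, ∑ j ∈ Finset.range (J + 1),
        ‖roundNoise f (gradField g ξ r ω) η (θ ω) (l ω) i j‖ ^ 2 ∂μ ≤ (J + 1) * δ ^ 2 := by
      intro i
      rw [integral_finsetSum _ (hi i)]
      refine (Finset.sum_le_sum fun j hj => (h.integrable_roundNoise_sq hS hf η hr hθ hl i
        (by have := Finset.mem_range.mp hj; omega)).2).trans (le_of_eq ?_)
      simp
    calc _ ≤ ((n : ℝ) * (J + 1)) * ∑ _i : Fin n, ((J : ℝ) + 1) * δ ^ 2 := by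
          exact mul_le_mul_of_nonneg_left (Finset.sum_le_sum fun i _ => h1 i) (by positivity)
      _ = _ := by
          rw [Finset.sum_const, Finset.card_univ, Fintype.card_fin, nsmul_eq_mul]
          ring

/-- The weights depend on the past only, so they can be moved into the test vector; each error then
averages to zero separately. -/
theorem IsStochasticModel.integral_inner_meanNoise (h : IsStochasticModel f g P δ)
    (hS : IsSampling P J μ ξ) (hf : ∀ i, Continuous (gradient (f i))) (η : ℝ) (hr : 1 ≤ r)
    (hθ : Measurable[past J ξ r] θ) (hl : Measurable[past J ξ r] l) {w : Ω → Vec d}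
    (hw : Measurable[past J ξ r] w) {C s : ℝ} (hC : ∀ ω, ‖w ω‖ ≤ C) (hs : ∀ ω i, |l ω i| ≤ s) :
    Integrable (fun ω => inner ℝ
      (meanNoise f (gradField g ξ r ω) η J (θ ω) (l ω)) (w ω)) μ ∧
    ∫ ω, inner ℝ (meanNoise f (gradField g ξ r ω) η J (θ ω) (l ω)) (w ω) ∂μ = 0 := by
  have heq : ∀ ω, inner ℝ (meanNoise f (gradField g ξ r ω) η J (θ ω) (l ω)) (w ω)
      = ∑ i, ∑ j ∈ Finset.range J, inner ℝ ((l ω i * (1 / (J : ℝ))) • w ω)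
        (roundNoise f (gradField g ξ r ω) η (θ ω) (l ω) i (j + 1)) := by
    intro ω
    rw [meanNoise, sum_inner]
    refine Finset.sum_congr rfl fun i _ => ?_
    rw [smul_smul, real_inner_smul_left, sum_inner, Finset.mul_sum]
    refine Finset.sum_congr rfl fun j _ => ?_
    rw [real_inner_smul_left, real_inner_comm]
  have key : ∀ i : Fin n, ∀ j ∈ Finset.range J, _ := fun i j hj =>
    h.integral_inner_roundNoise hS hf η hr hθ hl
      (w := fun ω => (l ω i * (1 / (J : ℝ))) • w ω) (C := s * (1 / (J : ℝ)) * C)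
      (by
        have hli : Measurable[past J ξ r] fun ω => l ω i := by fun_prop
        exact (hli.mul_const _).smul hw)
      (fun ω => by
        rw [norm_smul, Real.norm_eq_abs, abs_mul, abs_of_nonneg (by positivity : 0 ≤ 1 / (J : ℝ))]
        have h1 := (abs_nonneg _).trans (hs ω i)
        exact mul_le_mul (mul_le_mul_of_nonneg_right (hs ω i) (by positivity)) (hC ω)
          (norm_nonneg _) (by positivity)) i (j := j + 1)
      (by have := Finset.mem_range.mp hj; omega)
  simp_rw [heq]
  refine ⟨integrable_finsetSum _ fun i _ => integrable_finsetSum _ fun j hj => (key i j hj).1, ?_⟩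
  rw [integral_finsetSum _ fun i _ => integrable_finsetSum _ fun j hj => (key i j hj).1]
  refine Finset.sum_eq_zero fun i _ => ?_
  rw [integral_finsetSum _ fun j hj => (key i j hj).1]
  exact Finset.sum_eq_zero fun j hj => (key i j hj).2

end Expectation

/-! ### The step sizes and the potential -/

/-- Step sizes of accelerated type: `τ_r = η_r = 1 / (β (ρ + r))`, `σ_r = γ (ρ + r)` and
`ς_r = (ρ + r - 1) / (ρ + r)`. -/
noncomputable def acceleratedHyper (β γ ρ : ℝ) : Hyper where
  σ r := γ * (ρ + r)
  τ r := 1 / (β * (ρ + r))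
  ς r := (ρ + r - 1) / (ρ + r)
  η r := 1 / (β * (ρ + r))

theorem acceleratedHyper_pos {β γ ρ : ℝ} (hβ : 0 < β) (hγ : 0 < γ) (hρ : 1 < ρ) :
    (acceleratedHyper β γ ρ).Pos := by
  have h : ∀ r : ℕ, 0 < ρ + r - 1 := fun r => by
    have : (0 : ℝ) ≤ r := Nat.cast_nonneg r
    linarith
  have h' : ∀ r : ℕ, 0 < ρ + r := fun r => by linarith [h r]
  exact ⟨fun r => mul_pos hγ (h' r), fun r => one_div_pos.mpr (mul_pos hβ (h' r)),
    fun r => div_pos (h r) (h' r), fun r => one_div_pos.mpr (mul_pos hβ (h' r))⟩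

/-- The potential with weight `T`, for the current and previous primal points `x, xp` and the
current dual point `l`. -/
noncomputable def potential {d n : ℕ} (f : Fin n → Vec d → ℝ) (β γ : ℝ) (θs : Vec d) (ls : Vec n)
    (T : ℝ) (xp x : Vec d) (l : Vec n) : ℝ :=
  β * T ^ 2 * halfSqDist θs x + 1 / γ * halfSqDist ls l
    - T * inner ℝ (lossVec f x - lossVec f xp) (ls - l) + β * T ^ 2 / 2 * halfSqDist x xp

theorem halfSqDist_nonneg {k : ℕ} (x y : Vec k) : 0 ≤ halfSqDist x y := by
  unfold halfSqDist
  positivity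

/-- Young's inequality with parameter `1 / γ` bounds the cross term by the dual distance and, thanks
to `2 * γ * L ^ 2 = β`, exactly the last term of the potential. -/
theorem le_potential {d n : ℕ} {f : Fin n → Vec d → ℝ} {β γ L T : ℝ} (hγ : 0 < γ)
    (hγβ : 2 * γ * L ^ 2 = β) (θs : Vec d) (ls : Vec n) {xp x : Vec d} (l : Vec n)
    (hLip : ‖lossVec f x - lossVec f xp‖ ≤ L * ‖x - xp‖) :
    β * T ^ 2 * halfSqDist θs x ≤ potential f β γ θs ls T xp x l := by
  have h1 := neg_inner_le_half (one_div_pos.mpr hγ) (-(T • (lossVec f x - lossVec f xp))) (ls - l)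
  rw [inner_neg_left, neg_neg, real_inner_smul_left, norm_neg, norm_smul, mul_pow,
    Real.norm_eq_abs, sq_abs] at h1
  have h2 : 1 / (2 * (1 / γ)) = γ / 2 := by field_simp
  have h3 := pow_le_pow_left₀ (norm_nonneg _) hLip 2
  have h4 : γ / 2 * (T ^ 2 * ‖lossVec f x - lossVec f xp‖ ^ 2)
      ≤ γ / 2 * (T ^ 2 * (L * ‖x - xp‖) ^ 2) := by gcongr
  rw [h2] at h1
  have h5 : γ / 2 * (T ^ 2 * (L * ‖x - xp‖) ^ 2) = β * T ^ 2 / 2 * (‖x - xp‖ ^ 2 / 2) := by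
    rw [← hγβ]; ring
  unfold potential halfSqDist
  linarith

/-- The weighted form of the descent inequality with the accelerated step sizes. -/
theorem weighted_descent {β γ L μ T a a' b b' q q' e e' N C Z : ℝ} (hβ : 0 < β) (hγ : 0 < γ)
    (hμβ : μ = 4 * β) (hγβ : 2 * γ * L ^ 2 = β) (hT : 0 < T) (ha : 0 ≤ a)
    (h : 1 / (1 / (β * T)) * a' + 1 / (γ * T) * b' - q' + 1 / (2 * (1 / (β * T))) * e'
      ≤ (1 / (1 / (β * T)) - μ / 2) * a + 1 / (γ * T) * b - (T - 1) / T * q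
        + ((T - 1) / T) ^ 2 * (γ * T) * L ^ 2 * e - N + C * (1 / (β * T)) * Z) :
    β * T ^ 2 * a' + 1 / γ * b' - T * q' + β * T ^ 2 / 2 * e'
      ≤ β * (T - 1) ^ 2 * a + 1 / γ * b - (T - 1) * q + β * (T - 1) ^ 2 / 2 * e
        + (-(T * N) + C / β * Z) := by
  have h1 := mul_le_mul_of_nonneg_left h hT.le
  have e1 : T * (1 / (1 / (β * T)) * a' + 1 / (γ * T) * b' - q' + 1 / (2 * (1 / (β * T))) * e')
      = β * T ^ 2 * a' + 1 / γ * b' - T * q' + β * T ^ 2 / 2 * e' := by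
    field_simp
  have e2 : T * ((1 / (1 / (β * T)) - μ / 2) * a + 1 / (γ * T) * b - (T - 1) / T * q
        + ((T - 1) / T) ^ 2 * (γ * T) * L ^ 2 * e - N + C * (1 / (β * T)) * Z)
      = (β * T ^ 2 - 2 * β * T) * a + 1 / γ * b - (T - 1) * q
        + (2 * γ * L ^ 2) * (T - 1) ^ 2 / 2 * e + (-(T * N) + C / β * Z) := by
    rw [hμβ]
    field_simp
    ring
  rw [e1, e2, hγβ] at h1
  -- This is `T ^ 2 - 2 * T ≤ (T - 1) ^ 2`; the term `2 * β * T` is the contraction `μ / 2` times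
  -- `T`.
  have h2 : (β * T ^ 2 - 2 * β * T) * a ≤ β * (T - 1) ^ 2 * a :=
    mul_le_mul_of_nonneg_right (by nlinarith) ha
  linarith

/-- The constant in front of the squared noise. -/
noncomputable def noiseFactor (K s μ : ℝ) : ℝ := 64 * K ^ 2 * (s + 1) ^ 2 / μ + 4 * s ^ 2

/-! ### Convergence in expectation -/

section Convergence

variable {d n : ℕ} {f : Fin n → Vec d → ℝ} {m M s L μ β γ ρ : ℝ} {Θ : Set (Vec d)}
  {A B : Set (Vec n)} {φ : ℝ} {J : ℕ}

/-- Standing assumptions on the problem and on the parameters `β, γ, ρ` of the step sizes. -/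
structure IsTuned (f : Fin n → Vec d → ℝ) (m M s L μ β γ ρ : ℝ) (Θ : Set (Vec d))
    (Λ : Set (Vec n)) (J : ℕ) : Prop where
  m_pos : 0 < m
  M_pos : 0 < M
  regular : IsRegularLoss f m M
  μ_eq : μ = m - M * (s - 1) / 2
  μ_pos : 0 < μ
  sum_abs_le : ∀ l ∈ Λ, ∑ i, |l i| ≤ s
  sum_eq : ∀ l ∈ Λ, ∑ i, l i = 1
  s_nonneg : 0 ≤ s
  lipschitz : ∀ θ ∈ Θ, ∀ θ' ∈ Θ, ‖lossVec f θ - lossVec f θ'‖ ≤ L * ‖θ - θ'‖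
  μ_eq_β : μ = 4 * β
  γ_pos : 0 < γ
  γ_eq : 2 * γ * L ^ 2 = β
  J_pos : 1 ≤ J
  ρ_gt : 1 < ρ
  one_le : 1 ≤ β * ρ
  μ_le : 4 * μ ≤ β * ρ
  sM_le : 8 * (s * M) ≤ β * ρ
  M_le : M ≤ β * ρ
  K_le : 2 * (s * M * 2 ^ J) ≤ β * ρ
  K_sq_le : 256 * (s * M * 2 ^ J) ^ 2 / μ ≤ β * ρ
  primal_compact : IsCompact Θ
  primal_convex : Convex ℝ Θ
  dual_compact : IsCompact Λ
  dual_convex : Convex ℝ Λ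

namespace IsTuned

variable {X Ω : Type*} {g : Fin n → Vec d → X → ℝ} {ξ : Fin n → ℕ → ℕ → Ω → X} {R : ℕ}
  {θ₀ : Vec d} {l₀ : Vec n} {θ : ℕ → Ω → Vec d} {l : ℕ → Ω → Vec n} {θs : Vec d} {ls : Vec n}

theorem β_pos {Λ : Set (Vec n)} (h : IsTuned f m M s L μ β γ ρ Θ Λ J) : 0 < β := by
  linarith [h.μ_eq_β, h.μ_pos]

/-- The potential decreases in every round up to noise. -/
theorem potential_succ_le (h : IsTuned f m M s L μ β γ ρ Θ (integratedSet φ A B) J)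
    (hsol : IsSolution f Θ (integratedSet φ A B) (θs, ls))
    (hrun : IsRun f g Θ A B φ J (acceleratedHyper β γ ρ) ξ R θ₀ l₀ θ l) (hθ₀ : θ₀ ∈ Θ)
    (hl₀ : l₀ ∈ integratedSet φ A B) {k : ℕ} (hk : k < R) {ω : Ω}
    (hno : θ (k + 1) ω - (acceleratedHyper β γ ρ).τ (k + 1) •
      direction g J (acceleratedHyper β γ ρ) ξ θ l (k + 1) ω ∈ Θ) :
    potential f β γ θs ls (ρ + (k + 1 : ℕ)) (θ (k + 1) ω) (θ (k + 2) ω) (l (k + 2) ω)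
      ≤ potential f β γ θs ls (ρ + k) (θ k ω) (θ (k + 1) ω) (l (k + 1) ω)
        + (-((ρ + (k + 1 : ℕ)) * inner ℝ (meanNoise f (gradField g ξ (k + 1) ω)
              ((acceleratedHyper β γ ρ).η (k + 1)) J (θ (k + 1) ω) (l (k + 2) ω))
              (θ (k + 1) ω - θs))
          + noiseFactor (s * M * 2 ^ J) s μ / β * totalNoise f (gradField g ξ (k + 1) ω)
              ((acceleratedHyper β γ ρ).η (k + 1)) J (θ (k + 1) ω) (l (k + 2) ω) ^ 2) := by
  have hβ := h.β_pos
  have hH := acceleratedHyper_pos hβ h.γ_pos h.ρ_gt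
  set T : ℝ := ρ + (k + 1 : ℕ) with hT
  have hT1 : ρ + k = T - 1 := by rw [hT]; push_cast; ring
  have hT0 : 0 < T := by
    have := h.ρ_gt
    positivity
  have hρT : β * ρ ≤ β * T := by
    refine mul_le_mul_of_nonneg_left ?_ hβ.le
    rw [hT]
    have : (0 : ℝ) ≤ (k + 1 : ℕ) := Nat.cast_nonneg _
    linarith
  set τ : ℝ := 1 / (β * T) with hτ
  have hβT : 0 < β * T := mul_pos hβ hT0
  have hτ0 : 0 < τ := one_div_pos.mpr hβT
  -- Each lower bound on `β * ρ` in `IsTuned` is a smallness condition on the step size.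
  have hle : ∀ q, q ≤ β * ρ → q * τ ≤ 1 := fun q hq => by
    rw [hτ, mul_one_div, div_le_one hβT]
    exact hq.trans hρT
  have hx := hrun.mem_primal hθ₀ (by omega : k + 1 ≤ R + 1) ω
  have hxp := hrun.mem_primal hθ₀ (by omega : k ≤ R + 1) ω
  have hx' := hrun.mem_primal hθ₀ (by omega : k + 2 ≤ R + 1) ω
  have hl' := hrun.mem_dual hl₀ (by omega : k + 2 ≤ R + 1) ω
  have hprimal := hrun.primal_variational hH h.primal_convex (by omega : 1 ≤ k + 1)
    (by omega : k + 1 ≤ R) ω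
  have hdual := hrun.dual_variational hH h.dual_convex (by omega : 1 ≤ k + 1)
    (by omega : k + 1 ≤ R) ω
  set v := direction g J (acceleratedHyper β γ ρ) ξ θ l (k + 1) ω with hv
  set G := gradField g ξ (k + 1) ω with hG
  have hv2 : v = roundDirection G τ J (θ (k + 1) ω) (l (k + 2) ω) := rfl
  -- The unprojected point lies in `Θ`, so it is an admissible test point and the variational
  -- inequality forces equality.
  have hvx : θ (k + 2) ω = θ (k + 1) ω - τ • v := by
    have h1 := hprimal _ hno
    rw [real_inner_self_nonpos] at h1
    exact (sub_eq_zero.mp h1).symm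
  have hK := hle _ h.K_le
  have hd := norm_drift_le G (θ (k + 1) ω) h.m_pos h.M_pos h.regular hτ0
    (by rw [mul_comm]; exact hle _ h.M_le) (by linarith) (h.sum_abs_le _ hl') h.s_nonneg
    (h.sum_eq _ hl') h.J_pos
  have hN := norm_meanNoise_le f G (η := τ) (θ (k + 1) ω) (h.sum_abs_le _ hl') h.J_pos
  have hround := round_descent h.m_pos h.M_pos h.regular h.μ_eq h.μ_pos h.sum_abs_le h.sum_eq
    h.lipschitz hsol hxp hx hx' hl' hτ0 (mul_pos h.γ_pos hT0) (ς := (T - 1) / T) (v := v)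
    (by rw [hv2]; exact roundDirection_eq f G (θ (k + 1) ω) hτ0 h.J_pos (h.sum_eq _ hl'))
    hprimal hdual hd hN
    (by rw [hvx, sub_sub_cancel_left, norm_neg, norm_smul, Real.norm_of_nonneg hτ0.le])
    (by simpa using hle _ h.one_le) (hle _ h.μ_le) (hle _ h.sM_le)
    (by
      have := hle _ h.K_sq_le
      rwa [div_mul_eq_mul_div, div_le_one h.μ_pos] at this)
  have := weighted_descent hβ h.γ_pos h.μ_eq_β h.γ_eq hT0 (halfSqDist_nonneg _ _) hround
  unfold potential
  rw [hT1]
  exact this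

/-- The potential after `k` rounds is bounded by the initial distances and the accumulated noise. -/
theorem potential_le (h : IsTuned f m M s L μ β γ ρ Θ (integratedSet φ A B) J)
    (hsol : IsSolution f Θ (integratedSet φ A B) (θs, ls))
    (hrun : IsRun f g Θ A B φ J (acceleratedHyper β γ ρ) ξ R θ₀ l₀ θ l) (hθ₀ : θ₀ ∈ Θ)
    (hl₀ : l₀ ∈ integratedSet φ A B) {ω : Ω}
    (hno : ∀ r, 1 ≤ r → r ≤ R → θ r ω - (acceleratedHyper β γ ρ).τ r •
      direction g J (acceleratedHyper β γ ρ) ξ θ l r ω ∈ Θ) {k : ℕ} (hk : k ≤ R) :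
    potential f β γ θs ls (ρ + k) (θ k ω) (θ (k + 1) ω) (l (k + 1) ω)
      ≤ β * ρ ^ 2 * halfSqDist θs θ₀ + 1 / γ * halfSqDist ls l₀
        + ∑ j ∈ Finset.range k,
          (-((ρ + (j + 1 : ℕ)) * inner ℝ (meanNoise f (gradField g ξ (j + 1) ω)
              ((acceleratedHyper β γ ρ).η (j + 1)) J (θ (j + 1) ω) (l (j + 2) ω))
              (θ (j + 1) ω - θs))
          + noiseFactor (s * M * 2 ^ J) s μ / β * totalNoise f (gradField g ξ (j + 1) ω)
              ((acceleratedHyper β γ ρ).η (j + 1)) J (θ (j + 1) ω) (l (j + 2) ω) ^ 2) := by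
  induction k with
  | zero =>
    -- The cross term and the last term vanish because `θ 0 = θ 1`.
    simp [potential, hrun.primal_zero, hrun.primal_one, hrun.dual_one, halfSqDist]
  | succ k ih =>
    rw [Finset.sum_range_succ, ← add_assoc]
    have h1 := h.potential_succ_le hsol hrun hθ₀ hl₀ (by omega : k < R)
      (hno (k + 1) (by omega) hk)
    linarith [ih (by omega)]

variable [MeasurableSpace X] [MeasurableSpace Ω] {ν : Measure Ω} [IsProbabilityMeasure ν]
  {P : Fin n → Measure X} {δ : ℝ}

theorem noiseFactor_nonneg {Λ : Set (Vec n)} (h : IsTuned f m M s L μ β γ ρ Θ Λ J) :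
    0 ≤ noiseFactor (s * M * 2 ^ J) s μ := by
  have := h.μ_pos
  unfold noiseFactor
  positivity

/-- The mean squared distance of the last iterate to the solution. -/
theorem integral_sq_dist_le (h : IsTuned f m M s L μ β γ ρ Θ (integratedSet φ A B) J)
    (hsol : IsSolution f Θ (integratedSet φ A B) (θs, ls))
    (hrun : IsRun f g Θ A B φ J (acceleratedHyper β γ ρ) ξ R θ₀ l₀ θ l) (hθ₀ : θ₀ ∈ Θ)
    (hl₀ : l₀ ∈ integratedSet φ A B) (hmodel : IsStochasticModel f g P δ)
    (hS : IsSampling P J ν ξ) (hno : NoProjection g Θ J (acceleratedHyper β γ ρ) ξ ν R θ l) :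
    Integrable (fun ω => ‖θ (R + 1) ω - θs‖ ^ 2) ν ∧
    β * (ρ + R) ^ 2 / 2 * ∫ ω, ‖θ (R + 1) ω - θs‖ ^ 2 ∂ν
      ≤ β * ρ ^ 2 * halfSqDist θs θ₀ + 1 / γ * halfSqDist ls l₀
        + R * (noiseFactor (s * M * 2 ^ J) s μ / β * ((n * (J + 1)) ^ 2 * δ ^ 2)) := by
  have hβ := h.β_pos
  have hH := acceleratedHyper_pos hβ h.γ_pos h.ρ_gt
  have hfc := h.regular.continuous
  have hgc := h.regular.continuous_gradient h.m_pos h.M_pos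
  have hmeas : ∀ k ≤ R, _ := fun k hk => hrun.measurable_past hH hfc hmodel.measurable_sampleGrad
    h.primal_convex h.primal_compact ⟨θ₀, hθ₀⟩ h.dual_convex h.dual_compact ⟨l₀, hl₀⟩ hk
  -- The weight `l (k + 2)` is used in round `k + 1` but already determined by the earlier rounds.
  have hmeas' : ∀ k < R, Measurable[past J ξ (k + 1)] (l (k + 2)) := fun k hk =>
    hrun.measurable_dual_step hH hfc h.dual_convex h.dual_compact ⟨l₀, hl₀⟩
      (by omega : 1 ≤ k + 1) (by omega) (hmeas k hk.le).1 (hmeas k hk.le).2.1 (hmeas k hk.le).2.2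
  obtain ⟨D, hD⟩ := h.primal_compact.isBounded.exists_norm_le
  have hbound : ∀ k ≤ R, ∀ ω, ‖θ (k + 1) ω - θs‖ ≤ D + D := fun k hk ω =>
    (norm_sub_le _ _).trans (add_le_add (hD _ (hrun.mem_primal hθ₀ (by omega) ω))
      (hD _ hsol.mem_primal))
  have hθR : Measurable fun ω => ‖θ (R + 1) ω - θs‖ ^ 2 :=
    ((((hmeas R le_rfl).1.mono (hS.samplesIn_le _) le_rfl).sub_const θs).norm).pow_const 2
  have hint : Integrable (fun ω => ‖θ (R + 1) ω - θs‖ ^ 2) ν :=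
    Integrable.of_bound hθR.aestronglyMeasurable ((D + D) ^ 2)
      (Filter.Eventually.of_forall fun ω => by
        rw [Real.norm_of_nonneg (by positivity)]
        exact pow_le_pow_left₀ (norm_nonneg _) (hbound R le_rfl ω) 2)
  refine ⟨hint, ?_⟩
  set E : ℕ → Ω → ℝ := fun j ω => inner ℝ (meanNoise f (gradField g ξ (j + 1) ω)
    ((acceleratedHyper β γ ρ).η (j + 1)) J (θ (j + 1) ω) (l (j + 2) ω)) (θ (j + 1) ω - θs) with hE
  have hEint : ∀ j ∈ Finset.range R, Integrable (E j) ν ∧ ∫ ω, E j ω ∂ν = 0 := fun j hj => by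
    have hjR := Finset.mem_range.mp hj
    refine hmodel.integral_inner_meanNoise hS hgc _ (by omega : 1 ≤ j + 1) (hmeas j hjR.le).1
      (hmeas' j hjR) ((hmeas j hjR.le).1.sub_const θs) (hbound j hjR.le) (s := s) fun ω i => ?_
    exact (Finset.single_le_sum (f := fun i => |l (j + 2) ω i|) (fun _ _ => abs_nonneg _)
      (Finset.mem_univ i)).trans (h.sum_abs_le _ (hrun.mem_dual hl₀ (by omega) ω))
  have hSex : ∀ j, ∃ S : Ω → ℝ, j < R →
      (∀ ω, totalNoise f (gradField g ξ (j + 1) ω) ((acceleratedHyper β γ ρ).η (j + 1)) J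
        (θ (j + 1) ω) (l (j + 2) ω) ^ 2 ≤ S ω) ∧
      Integrable S ν ∧ ∫ ω, S ω ∂ν ≤ (n * (J + 1)) ^ 2 * δ ^ 2 := fun j => by
    by_cases hjR : j < R
    · obtain ⟨S, hS'⟩ := hmodel.integrable_totalNoise_sq hS hgc
        ((acceleratedHyper β γ ρ).η (j + 1)) (by omega : 1 ≤ j + 1) (hmeas j hjR.le).1
        (hmeas' j hjR)
      exact ⟨S, fun _ => hS'⟩
    · exact ⟨0, fun hj => absurd hj hjR⟩
  choose S hSprop using hSex
  set C := noiseFactor (s * M * 2 ^ J) s μ / β with hC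
  have hC0 : 0 ≤ C := div_nonneg h.noiseFactor_nonneg hβ.le
  set c := β * ρ ^ 2 * halfSqDist θs θ₀ + 1 / γ * halfSqDist ls l₀ with hc
  have hae : ∀ᵐ ω ∂ν, β * (ρ + R) ^ 2 / 2 * ‖θ (R + 1) ω - θs‖ ^ 2
      ≤ c + ∑ j ∈ Finset.range R, (-((ρ + (j + 1 : ℕ)) * E j ω) + C * S j ω) := by
    have hno' : ∀ᵐ ω ∂ν, ∀ r, 1 ≤ r → r ≤ R → θ r ω - (acceleratedHyper β γ ρ).τ r •
        direction g J (acceleratedHyper β γ ρ) ξ θ l r ω ∈ Θ := by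
      refine ae_all_iff.mpr fun r => ?_
      by_cases hr : 1 ≤ r ∧ r ≤ R
      · filter_upwards [hno r hr.1 hr.2] with ω hω _ _ using hω
      · exact Filter.Eventually.of_forall fun ω h1 h2 => absurd ⟨h1, h2⟩ hr
    filter_upwards [hno'] with ω hω
    have h1 := le_potential (T := ρ + R) h.γ_pos h.γ_eq θs ls (l (R + 1) ω)
      (h.lipschitz _ (hrun.mem_primal hθ₀ le_rfl ω) _ (hrun.mem_primal hθ₀ (Nat.le_succ R) ω))
    have h2 := h.potential_le hsol hrun hθ₀ hl₀ hω le_rfl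
    have h3 : β * (ρ + R) ^ 2 / 2 * ‖θ (R + 1) ω - θs‖ ^ 2
        = β * (ρ + R) ^ 2 * halfSqDist θs (θ (R + 1) ω) := by
      rw [halfSqDist, norm_sub_rev]; ring
    rw [h3]
    refine (h1.trans h2).trans (add_le_add_right (Finset.sum_le_sum fun j hj => ?_) _)
    refine add_le_add_right (mul_le_mul_of_nonneg_left ?_ hC0) _
    exact (hSprop j (Finset.mem_range.mp hj)).1 ω
  have hterm : ∀ j ∈ Finset.range R,
      Integrable (fun ω => -((ρ + (j + 1 : ℕ)) * E j ω) + C * S j ω) ν := fun j hj =>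
    (((hEint j hj).1.const_mul _).neg).add
      ((hSprop j (Finset.mem_range.mp hj)).2.1.const_mul _)
  have hmono := integral_mono_ae (hint.const_mul (β * (ρ + R) ^ 2 / 2))
    ((integrable_const c).add (integrable_finsetSum _ hterm)) hae
  rw [integral_const_mul] at hmono
  refine hmono.trans ?_
  have hsum : ∫ ω, (c + ∑ j ∈ Finset.range R, (-((ρ + (j + 1 : ℕ)) * E j ω) + C * S j ω)) ∂ν
      = c + ∑ j ∈ Finset.range R, C * ∫ ω, S j ω ∂ν := by
    rw [integral_add (integrable_const c) (integrable_finsetSum _ hterm),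
      integral_finsetSum _ hterm]
    congr 1
    · simp
    · refine Finset.sum_congr rfl fun j hj => ?_
      have hneg : Integrable (fun ω => -((ρ + (j + 1 : ℕ)) * E j ω)) ν :=
        ((hEint j hj).1.const_mul _).neg
      rw [integral_add hneg ((hSprop j (Finset.mem_range.mp hj)).2.1.const_mul _), integral_neg, integral_const_mul,
        integral_const_mul, (hEint j hj).2]
      ring
  refine (le_of_eq hsum).trans (add_le_add_right ?_ _)
  refine (Finset.sum_le_sum fun j hj => mul_le_mul_of_nonneg_left
    (hSprop j (Finset.mem_range.mp hj)).2.2 hC0).trans (le_of_eq ?_)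
  simp

end IsTuned

end Convergence

theorem exists_isTuned {d n : ℕ} {f : Fin n → Vec d → ℝ} {m M s L : ℝ} {Θ : Set (Vec d)}
    {Λ : Set (Vec n)} {J : ℕ} (hm : 0 < m) (hM : 0 < M) (hf : IsRegularLoss f m M)
    (hμ : 0 < m - M * (s - 1) / 2) (hs : ∀ l ∈ Λ, ∑ i, |l i| ≤ s) (hl : ∀ l ∈ Λ, ∑ i, l i = 1)
    (hs0 : 0 ≤ s) (hL : 0 < L)
    (hLip : ∀ θ ∈ Θ, ∀ θ' ∈ Θ, ‖lossVec f θ - lossVec f θ'‖ ≤ L * ‖θ - θ'‖) (hJ : 1 ≤ J)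
    (hΘ : IsCompact Θ) (hΘ_conv : Convex ℝ Θ) (hΛ : IsCompact Λ) (hΛ_conv : Convex ℝ Λ)
    {ε : ℝ} (hε : 0 < ε) :
    ∃ μ β γ ρ : ℝ, IsTuned f m M s L μ β γ ρ Θ Λ J ∧ 1 / ε ≤ β * ρ := by
  set μ := m - M * (s - 1) / 2 with hμ_def
  have hβ : 0 < μ / 4 := by positivity
  set K := s * M * 2 ^ J with hK
  have hK0 : 0 ≤ K := by positivity
  set Q := 1 / ε + 1 + 4 * μ + 8 * (s * M) + M + 2 * K + 256 * K ^ 2 / μ with hQ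
  have h1 : 0 ≤ 1 / ε := by positivity
  have h2 : 0 ≤ 8 * (s * M) := by positivity
  have h3 : 0 ≤ 256 * K ^ 2 / μ := by positivity
  have hQρ : Q ≤ μ / 4 * (2 + Q / (μ / 4)) := by
    rw [mul_add, mul_div_cancel₀ _ hβ.ne']
    linarith
  have hQ0 : 0 ≤ Q / (μ / 4) := div_nonneg (by linarith) hβ.le
  -- `β` and `γ` are dictated by the two equations. `Q` is the sum of all required lower bounds, so
  -- `ρ = 2 + Q / β` meets them at once and `2` ensures `1 < ρ`.
  refine ⟨μ, μ / 4, μ / 4 / (2 * L ^ 2), 2 + Q / (μ / 4), ?_, by linarith⟩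
  exact {
    m_pos := hm, M_pos := hM, regular := hf, μ_eq := hμ_def, μ_pos := hμ, sum_abs_le := hs
    sum_eq := hl, s_nonneg := hs0, lipschitz := hLip, μ_eq_β := by ring, γ_pos := by positivity
    γ_eq := by field_simp, J_pos := hJ, ρ_gt := by linarith, one_le := by linarith
    μ_le := by linarith, sM_le := by linarith, M_le := by linarith, K_le := by linarith
    K_sq_le := by linarith, primal_compact := hΘ, primal_convex := hΘ_conv, dual_compact := hΛ
    dual_convex := hΛ_conv }

end ScaffPDIA

/-! ### The main theorem -/

theorem theorem3 {d n : ℕ} (Θ : Set (ScaffPDIA.Vec d)) (A B : Set (ScaffPDIA.Vec n)) (φ : ℝ)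
    (f : Fin n → ScaffPDIA.Vec d → ℝ) (m M L : ℝ) (J : ℕ)
    (hΘ_ne : Θ.Nonempty) (hΘ_cpt : IsCompact Θ) (hΘ_conv : Convex ℝ Θ)
    (hA_ne : A.Nonempty) (hA_cpt : IsCompact A) (hA_sub : A ⊆ ScaffPDIA.simplex n)
    (hB_ne : B.Nonempty) (hB_cpt : IsCompact B) (hB_sub : B ⊆ ScaffPDIA.simplex n)
    (hφ_nonneg : 0 ≤ φ) (hφ_lt : φ < 1)
    (hΛ_conv : Convex ℝ (ScaffPDIA.integratedSet φ A B))
    (hm : 0 < m) (hM : 0 < M) (hf : ScaffPDIA.IsRegularLoss f m M)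
    (hL : 0 < L)
    (hf_lip : ∀ θ ∈ Θ, ∀ θ' ∈ Θ,
      ‖ScaffPDIA.lossVec f θ - ScaffPDIA.lossVec f θ'‖ ≤ L * ‖θ - θ'‖)
    (hJ : 2 ≤ J)
    (hΛ_norm : ScaffPDIA.l1Norm (ScaffPDIA.integratedSet φ A B) < 1 + 2 * m / M) :
    ∃ θs ∈ Θ, ∃ Λs ⊆ ScaffPDIA.integratedSet φ A B, Λs.Nonempty ∧
      {p | ScaffPDIA.IsSolution f Θ (ScaffPDIA.integratedSet φ A B) p} = {θs} ×ˢ Λs ∧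
      (∀ θs' ∈ Θ, ∀ Λs' ⊆ ScaffPDIA.integratedSet φ A B, Λs'.Nonempty →
        {p | ScaffPDIA.IsSolution f Θ (ScaffPDIA.integratedSet φ A B) p} = {θs'} ×ˢ Λs' →
        θs' = θs ∧ Λs' = Λs) ∧
      ∀ ε : ℝ, 0 < ε →
        ∃ H : ScaffPDIA.Hyper, H.Pos ∧ (∀ r, H.τ r ≤ ε ∧ H.η r ≤ ε) ∧
        ∃ C₁ C₂ : ℝ, 1 ≤ C₁ ∧ 1 ≤ C₂ ∧
        ∀ (X : Type*) [MeasurableSpace X] (Ω : Type*) [MeasurableSpace Ω]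
          (μ : Measure Ω) [IsProbabilityMeasure μ]
          (g : Fin n → ScaffPDIA.Vec d → X → ℝ) (P : Fin n → Measure X) (δ : ℝ)
          (ξ : Fin n → ℕ → ℕ → Ω → X),
          0 ≤ δ → ScaffPDIA.IsStochasticModel f g P δ → ScaffPDIA.IsSampling P J μ ξ →
          ∀ R : ℕ, 1 ≤ R → ∀ θ₀ ∈ Θ, ∀ l₀ ∈ ScaffPDIA.integratedSet φ A B, ∀ ls ∈ Λs,
          ∀ (θ : ℕ → Ω → ScaffPDIA.Vec d) (l : ℕ → Ω → ScaffPDIA.Vec n),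
            ScaffPDIA.IsRun f g Θ A B φ J H ξ R θ₀ l₀ θ l →
            ScaffPDIA.NoProjection g Θ J H ξ μ R θ l →
            Integrable (fun ω => ‖θ (R + 1) ω - θs‖ ^ 2) μ ∧
            ∫ ω, ‖θ (R + 1) ω - θs‖ ^ 2 ∂μ ≤ C₁ * δ ^ 2 / R + C₂ / (R : ℝ) ^ 2 *
              (ScaffPDIA.halfSqDist θs θ₀ + ScaffPDIA.halfSqDist ls l₀
                + ScaffPDIA.objective f θ₀ ls - ScaffPDIA.objective f θs l₀) := by
  have hΛ_cpt := ScaffPDIA.isCompact_integratedSet (φ := φ) hA_cpt hB_cpt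
  have hΛ_ne := ScaffPDIA.integratedSet_nonempty (φ := φ) hA_ne hB_ne
  have hsum : ∀ l ∈ ScaffPDIA.integratedSet φ A B, ∑ i, l i = 1 := fun l hl =>
    ScaffPDIA.sum_eq_one_of_mem_integratedSet hφ_lt hA_sub hB_sub hl
  set s := ScaffPDIA.l1Norm (ScaffPDIA.integratedSet φ A B)
  have hs : ∀ l ∈ ScaffPDIA.integratedSet φ A B, ∑ i, |l i| ≤ s := fun l hl =>
    ScaffPDIA.sum_abs_le_l1Norm hΛ_cpt hl
  have hs0 : 0 ≤ s := by
    obtain ⟨l, hl⟩ := hΛ_ne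
    exact (Finset.sum_nonneg fun _ _ => abs_nonneg _).trans (hs l hl)
  have hμ : 0 < m - M * (s - 1) / 2 := by
    have h1 : s - 1 < 2 * m / M := by linarith
    rw [lt_div_iff₀ hM] at h1
    linarith
  obtain ⟨θs, hθs, Λs, hΛs, hΛs_ne, hsol⟩ := ScaffPDIA.exists_solutionSet_eq hm hM hf hμ hs hsum
    hΘ_ne hΘ_cpt hΘ_conv hΛ_ne hΛ_cpt hΛ_conv
  refine ⟨θs, hθs, Λs, hΛs, hΛs_ne, hsol, ?_, ?_⟩
  · intro θs' _ Λs' _ hne' heq'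
    -- A nonempty product determines its factors.
    rw [hsol, Set.prod_eq_prod_iff_of_nonempty ((Set.singleton_nonempty θs).prod hΛs_ne)] at heq'
    exact ⟨(Set.singleton_injective heq'.1).symm, heq'.2.symm⟩
  · intro ε hε
    obtain ⟨μ, β, γ, ρ, htuned, hερ⟩ := ScaffPDIA.exists_isTuned hm hM hf hμ hs hsum hs0 hL hf_lip
      (by omega : 1 ≤ J) hΘ_cpt hΘ_conv hΛ_cpt hΛ_conv hε
    have hβ := htuned.β_pos
    have hγ := htuned.γ_pos
    have hρ := htuned.ρ_gt
    have hstep : ∀ r : ℕ, 1 / (β * (ρ + r)) ≤ ε := fun r => by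
      rw [one_div_le (by positivity) hε]
      exact hερ.trans (mul_le_mul_of_nonneg_left (by simp) hβ.le)
    set E := ScaffPDIA.noiseFactor (s * M * 2 ^ J) s μ / β * ((n : ℝ) * (J + 1)) ^ 2 with hE
    set C₂ := max 1 (max (2 * ρ ^ 2) (2 / (β * γ))) with hC₂
    refine ⟨ScaffPDIA.acceleratedHyper β γ ρ, ScaffPDIA.acceleratedHyper_pos hβ hγ hρ,
      fun r => ⟨hstep r, hstep r⟩, max 1 (2 * E / β), C₂, le_max_left _ _, le_max_left _ _, ?_⟩
    intro X _ Ω _ ν _ g P δ ξ _ hmodel hS R hR θ₀ hθ₀ l₀ hl₀ ls hls θ l hrun hno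
    have hsolp : ScaffPDIA.IsSolution f Θ (ScaffPDIA.integratedSet φ A B) (θs, ls) := by
      have : (θs, ls) ∈ {p | ScaffPDIA.IsSolution f Θ (ScaffPDIA.integratedSet φ A B) p} := by
        rw [hsol]; exact ⟨rfl, hls⟩
      exact this
    obtain ⟨hint, hle⟩ := htuned.integral_sq_dist_le hsolp hrun hθ₀ hl₀ hmodel hS hno
    refine ⟨hint, ?_⟩
    -- The potential argument needs only the two distances; the initial gap is nonnegative, so
    -- adding it to the bound is harmless.
    have hgap : ScaffPDIA.objective f θs l₀ ≤ ScaffPDIA.objective f θ₀ ls :=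
      (hsolp.dual_le l₀ hl₀).trans (hsolp.le_primal θ₀ hθ₀)
    have hR0 : (0 : ℝ) < R := by exact_mod_cast hR
    set I := ∫ ω, ‖θ (R + 1) ω - θs‖ ^ 2 ∂ν
    have hI0 : 0 ≤ I := integral_nonneg fun _ => sq_nonneg _
    set a := ScaffPDIA.halfSqDist θs θ₀
    set b := ScaffPDIA.halfSqDist ls l₀
    have ha : 0 ≤ a := ScaffPDIA.halfSqDist_nonneg _ _
    have hb : 0 ≤ b := ScaffPDIA.halfSqDist_nonneg _ _
    have h1 : β * (R : ℝ) ^ 2 / 2 * I ≤ β * (ρ + R) ^ 2 / 2 * I := by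
      gcongr
      linarith
    have h2 : I ≤ 2 / (β * (R : ℝ) ^ 2) * (β * ρ ^ 2 * a + 1 / γ * b + R * (E * δ ^ 2)) := by
      have h3 := mul_le_mul_of_nonneg_left (h1.trans hle)
        (by positivity : 0 ≤ 2 / (β * (R : ℝ) ^ 2))
      calc I = 2 / (β * (R : ℝ) ^ 2) * (β * (R : ℝ) ^ 2 / 2 * I) := by field_simp
        _ ≤ _ := h3
        _ = _ := by rw [hE]; ring
    have h4 : 2 / (β * (R : ℝ) ^ 2) * (β * ρ ^ 2 * a + 1 / γ * b + R * (E * δ ^ 2))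
        = 2 * E / β * δ ^ 2 / R + 1 / (R : ℝ) ^ 2 * (2 * ρ ^ 2 * a + 2 / (β * γ) * b) := by
      field_simp
      ring
    have h5 : 2 * ρ ^ 2 ≤ C₂ := (le_max_left _ _).trans (le_max_right _ _)
    have h6 : 2 / (β * γ) ≤ C₂ := (le_max_right _ _).trans (le_max_right _ _)
    have h7 : 0 ≤ C₂ := zero_le_one.trans (le_max_left _ _)
    have h8 : 2 * ρ ^ 2 * a + 2 / (β * γ) * b ≤ C₂ * (a + b + ScaffPDIA.objective f θ₀ ls
        - ScaffPDIA.objective f θs l₀) := by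
      nlinarith [mul_le_mul_of_nonneg_right h5 ha, mul_le_mul_of_nonneg_right h6 hb,
        mul_nonneg h7 (sub_nonneg.mpr hgap)]
    rw [h4] at h2
    refine h2.trans (add_le_add ?_ ?_)
    · gcongr
      exact le_max_right _ _
    · rw [one_div_mul_eq_div, div_mul_eq_mul_div C₂]
      exact div_le_div_of_nonneg_right h8 (sq_nonneg _)
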